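/- Conventions. For $f\in L^1(\mathbb R^3)$ put $\hat f(\xi)=\int f(x)e^{-2\pi i\langle \xi,x\rangle}\,dx$, extended to $L^2(\mathbb R^3)$ as usual. For $\beta\ge 0$, $H^\beta(\mathbb R^3)$ is the space of $f\in L^2(\mathbb R^3)$ with $\int(1+|\xi|^2)^\beta|\hat f(\xi)|^2\,d\xi<\infty$. For $\delta,\gamma>0$, a function $\psi\in L^2(\mathbb R^3)$ is called $(\delta,\gamma)$-feasible if there are constants $C>0$ and $q\ge q'>0$, $q\ge r>0$, $q\ge s>0$ such that $$|\hat\psi(\xi)|\le C\,\min\{1,|q\xi_1|^{\delta}\}\,\min\{1,|q'\xi_1|^{-\gamma}\}\,\min\{1,|r\xi_2|^{-\gamma}\}\,\min\{1,|s\xi_3|^{-\gamma}\}$$ for (almost) all $\xi\in\mathbb R^3$. Fix $\alpha\in(1,2]$ and $c=(c_1,c_2)$ with $c_1,c_2>0$. Let $A_{2^j}=\mathrm{diag}(2^{j\alpha/2},2^{j/2},2^{j/2})$, $M_c=\mathrm{diag}(c_1,c_2,c_2)$, and $$S_k=\begin{pmatrix}1&k_1&k_2\\0&1&0\\0&0&1\end{pmatrix}\quad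 (k=(k_1,k_2)\in\mathbb Z^2).$$ Let $\Lambda$ be the set of triples $\lambda=(j,k,m)$ with $j\in\mathbb N_0$, $m\in\mathbb Z^3$, $k\in\mathbb Z^2$ and $|k_1|,|k_2|\le\lceil 2^{j(\alpha-1)/2}\rceil$. For $\lambda\in\Lambda$ let $$\psi_\lambda(x)=2^{j(\alpha+2)/4}\,\psi(S_kA_{2^j}x-M_cm).$$ For $g\in L^2(\mathbb R^3)$ and $n\ge1$, let $|c(g)^*_n|$ be the modulus of the $n$th largest (in modulus, counted with multiplicity) of the shearlet coefficients $\langle g,\psi_\lambda\rangle$, $\lambda\in\Lambda$; that is, the non-increasing rearrangement of $(|\langle g,\psi_\lambda\rangle|)_{\lambda\in\Lambda}$. Proposition. Let $\beta\ge0$, and let $g\in H^\beta(\mathbb R^3)$ with $\operatorname{supp} g\subset[0,1]^3$. Suppose that $\psi\in L^2(\mathbb R^3)$ is compactly supported and $(\delta,\gamma)$-feasible with $\delta>2\gamma+\beta$ and $\gamma>3$. Then there is a constant $C$ such that $$\sum_{n>N}|c(g)^*_n|^2\le C\,N^{-2\beta/3}\qquad\text{for all integers } N\ge1 .$$ -/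

import Mathlib

open MeasureTheory FourierTransform
open scoped ENNReal Matrix

noncomputable section

/-- Euclidean space `ℝ³`. -/
abbrev R3 : Type := EuclideanSpace ℝ (Fin 3)

/-- The complex Hilbert space `L²(ℝ³)`. -/
abbrev L2R3 : Type := Lp ℂ 2 (volume : Measure R3)

/-- `f` vanishes almost everywhere outside `K`; for closed `K` this says that the (essential) support
of `f` is contained in `K`. -/
def SupportedIn (f : L2R3) (K : Set R3) : Prop :=
  ∀ᵐ x ∂(volume : Measure R3), x ∉ K → f x = 0

/-- `f ∈ L²(ℝ³)` is compactly supported. -/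
def CompactlySupported (f : L2R3) : Prop :=
  ∃ K : Set R3, IsCompact K ∧ SupportedIn f K

/-- The unit cube `[0,1]³`. -/
def unitCube : Set R3 := {x | ∀ i, x i ∈ Set.Icc (0 : ℝ) 1}

/-- `g ∈ L²(ℝ³)` belongs to `H^β(ℝ³)`, i.e. `∫ (1 + |ξ|²)^β |ĝ(ξ)|² dξ < ∞`, where
`ĝ(ξ) = ∫ g(x) e^{-2πi⟨ξ,x⟩} dx`. -/
def InSobolev (β : ℝ) (g : L2R3) : Prop :=
  TemperedDistribution.MemSobolev β 2 (Lp.toTemperedDistribution g)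

/-- `(δ, γ)`-feasible shearlets. The Fourier transform is the Plancherel transform of `L²(ℝ³)`, an
almost everywhere class, so the bound is required almost everywhere. In particular the value that
the real power takes at base `0` with a negative exponent plays no role. -/
def IsFeasible (δ γ : ℝ) (ψ : L2R3) : Prop :=
  ∃ C q q' r s : ℝ, 0 < q' ∧ q' ≤ q ∧ 0 < r ∧ r ≤ q ∧ 0 < s ∧ s ≤ q ∧
    ∀ᵐ ξ ∂(volume : Measure R3),
      ‖(𝓕 ψ : L2R3) ξ‖ ≤ C *
        (min 1 (|q * ξ 0| ^ δ) * min 1 (|q' * ξ 0| ^ (-γ)) *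
          min 1 (|r * ξ 1| ^ (-γ)) * min 1 (|s * ξ 2| ^ (-γ)))

/-- The scaling matrix `A_{2^j} = diag(2^{jα/2}, 2^{j/2}, 2^{j/2})`. -/
def scalingMatrix (α : ℝ) (j : ℕ) : Matrix (Fin 3) (Fin 3) ℝ :=
  !![(2 : ℝ) ^ (j * α / 2), 0, 0;
     0, (2 : ℝ) ^ ((j : ℝ) / 2), 0;
     0, 0, (2 : ℝ) ^ ((j : ℝ) / 2)]

/-- The shear matrix `S_k`, `k = (k₁, k₂) ∈ ℤ²`. -/
def shearMatrix (k : ℤ × ℤ) : Matrix (Fin 3) (Fin 3) ℝ :=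
  !![1, (k.1 : ℝ), (k.2 : ℝ);
     0, 1, 0;
     0, 0, 1]

/-- The matrix `M_c = diag(c₁, c₂, c₂)` generating the translation lattice `M_c ℤ³`. -/
def latticeMatrix (c : ℝ × ℝ) : Matrix (Fin 3) (Fin 3) ℝ :=
  !![c.1, 0, 0;
     0, c.2, 0;
     0, 0, c.2]

/-- The lattice point `M_c m`, `m ∈ ℤ³`. -/
def latticePoint (c : ℝ × ℝ) (m : Fin 3 → ℤ) : R3 :=
  WithLp.toLp 2 (latticeMatrix c *ᵥ fun i => (m i : ℝ))

/-- The index set `Λ` of the shearlet system: the triples `(j, k, m)` with `j ≥ 0`, `k ∈ ℤ²`,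
`m ∈ ℤ³` and `|k₁|, |k₂| ≤ ⌈2^{j(α-1)/2}⌉`. -/
def ShearletIndex (α : ℝ) : Type :=
  {l : ℕ × (ℤ × ℤ) × (Fin 3 → ℤ) //
    |l.2.1.1| ≤ ⌈(2 : ℝ) ^ (l.1 * (α - 1) / 2)⌉ ∧ |l.2.1.2| ≤ ⌈(2 : ℝ) ^ (l.1 * (α - 1) / 2)⌉}

/-- The shearlet `ψ_{j,k,m}(x) = 2^{j(α+2)/4} ψ(S_k A_{2^j} x - M_c m)`. -/
def shearlet (α : ℝ) (c : ℝ × ℝ) (ψ : R3 → ℂ) (j : ℕ) (k : ℤ × ℤ) (m : Fin 3 → ℤ) (x : R3) : ℂ :=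
  (((2 : ℝ) ^ (j * (α + 2) / 4) : ℝ) : ℂ) *
    ψ (WithLp.toLp 2 ((shearMatrix k * scalingMatrix α j) *ᵥ x.ofLp) - latticePoint c m)

/-- The shearlet coefficients `⟨g, ψ_λ⟩ = ∫ g(x) conj(ψ_λ(x)) dx`, `λ ∈ Λ`. -/
def shearletCoeff (α : ℝ) (c : ℝ × ℝ) (ψ g : L2R3) (l : ShearletIndex α) : ℂ :=
  ∫ x : R3, g x * (starRingEnd ℂ) (shearlet α c ψ l.1.1 l.1.2.1 l.1.2.2 x)

/-- `sortedAbs a n = |a*_n|`, `n ≥ 1`: the modulus of the `n`-th largest (in modulus) term of the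
family `a`, with multiplicity, i.e. the least `t` such that fewer than `n` of the terms have modulus
greater than `t`. -/
def sortedAbs {ι : Type*} (a : ι → ℂ) (n : ℕ) : ℝ≥0∞ :=
  sInf {t : ℝ≥0∞ | {i | t < ‖a i‖ₑ}.encard < n}

end

/-!
On the Fourier side, feasibility bounds `ψ̂` by `|ξ₁|^β` times a weight that vanishes at `ξ₁ = 0`
and decays in every direction, while the Sobolev hypothesis writes `ĝ` as `(1 + |ξ|²)^(-β/2) h` with
`h ∈ L²`. In the coordinates of `ψ_{j,k,m}` the product of the two powers of `|ξ|` gains the factor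
`2^(-αβj/2)`. For fixed `(j, k)` the coefficients are the integrals of one function against the
characters of a lattice, so a large sieve inequality and its dual bound their `ℓ²` norm; summing the
weight over shears and scales gives `∑_λ 2^(αβj) |⟨g, ψ_λ⟩|² < ∞`.

By compactness of the supports only `O(2^(3αj/2))` coefficients at scale `j` are nonzero. Discarding
all scales below `J`, where `2^(3αJ/2) ≈ N`, therefore removes at most `N` of them and leaves the
energy `O(2^(-αβJ)) = O(N^(-2β/3))`.
-/

section Fourier

theorem det_adjoint {E : Type*} [NormedAddCommGroup E] [InnerProductSpace ℝ E]
    [FiniteDimensional ℝ E] (A : E →ₗ[ℝ] E) :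
    LinearMap.det A.adjoint = LinearMap.det A := by
  let b := stdOrthonormalBasis ℝ E
  rw [← LinearMap.det_toMatrix b.toBasis, LinearMap.toMatrix_adjoint, Matrix.det_conjTranspose,
    star_trivial, LinearMap.det_toMatrix]

variable {E F : Type*} [NormedAddCommGroup E] [InnerProductSpace ℝ E] [FiniteDimensional ℝ E]
  [MeasurableSpace E] [BorelSpace E] [NormedAddCommGroup F] [InnerProductSpace ℂ F]

variable {A : E →ₗ[ℝ] E}

theorem measurableEmbedding_linearMap_sub (hA : LinearMap.det A ≠ 0) (v : E) :
    MeasurableEmbedding fun x => A x - v := by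
  refine (A.continuous_of_finiteDimensional.sub continuous_const).measurableEmbedding
    fun x y hxy => ?_
  exact (LinearEquiv.ofIsUnitDet (v := Module.finBasis ℝ E) (v' := Module.finBasis ℝ E)
    (f := A) (by rwa [LinearMap.det_toMatrix, isUnit_iff_ne_zero])).injective (sub_left_inj.1 hxy)

variable (μ : Measure E) [μ.IsAddHaarMeasure]

theorem map_linearMap_sub (hA : LinearMap.det A ≠ 0) (v : E) :
    μ.map (fun x => A x - v) = ENNReal.ofReal |LinearMap.det A|⁻¹ • μ := by
  have hcomp := Measure.map_map (μ := μ) (measurable_sub_const v)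
    A.continuous_of_finiteDimensional.measurable
  rw [Measure.map_linearMap_addHaar_eq_smul_addHaar μ hA, abs_inv, Measure.map_smul,
    map_sub_right_eq_self] at hcomp
  exact hcomp.symm

theorem integral_comp_linearMap_sub {G : Type*} [NormedAddCommGroup G] [NormedSpace ℝ G]
    (hA : LinearMap.det A ≠ 0) (v : E) (f : E → G) :
    ∫ x, f (A x - v) ∂μ = |LinearMap.det A|⁻¹ • ∫ x, f x ∂μ := by
  have hmap := (measurableEmbedding_linearMap_sub hA v).integral_map (μ := μ) f
  rw [map_linearMap_sub μ hA, integral_smul_measure, ENNReal.toReal_ofReal (by positivity)] at hmap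
  exact hmap.symm

theorem lintegral_comp_linearMap_sub (hA : LinearMap.det A ≠ 0) (v : E) (f : E → ℝ≥0∞) :
    ∫⁻ x, f (A x - v) ∂μ = ENNReal.ofReal |LinearMap.det A|⁻¹ * ∫⁻ x, f x ∂μ := by
  have hmap := (measurableEmbedding_linearMap_sub hA v).lintegral_map (μ := μ) f
  rw [map_linearMap_sub μ hA, lintegral_smul_measure] at hmap
  exact hmap.symm

theorem quasiMeasurePreserving_linearMap_sub (hA : LinearMap.det A ≠ 0) (v : E) :
    Measure.QuasiMeasurePreserving (fun x => A x - v) μ μ :=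
  ⟨(measurableEmbedding_linearMap_sub hA v).measurable,
    map_linearMap_sub μ hA v ▸ Measure.smul_absolutelyContinuous⟩

theorem memLp_comp_linearMap_sub {G : Type*} [NormedAddCommGroup G] (hA : LinearMap.det A ≠ 0)
    (v : E) {f : E → G} {p : ℝ≥0∞} (hf : MemLp f p μ) : MemLp (fun x => f (A x - v)) p μ := by
  refine MemLp.comp_of_map (f := fun x => A x - v) ?_
    (measurableEmbedding_linearMap_sub hA v).measurable.aemeasurable
  rw [map_linearMap_sub μ hA]
  exact hf.smul_measure ENNReal.ofReal_ne_top

theorem fourier_comp_linearMap_sub (hA : LinearMap.det A ≠ 0) (v : E) (f : E → F) (η : E) :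
    𝓕 (fun x => f (A x - v)) (A.adjoint η) =
      |LinearMap.det A|⁻¹ • Real.fourierChar (-inner ℝ v η) • 𝓕 f η := by
  have hphase : ∀ x, Real.fourierChar (-inner ℝ x (A.adjoint η)) • f (A x - v) =
      Real.fourierChar (-inner ℝ v η) •
        Real.fourierChar (-inner ℝ (A x - v) η) • f (A x - v) := by
    intro x
    rw [smul_smul, ← AddChar.map_add_eq_mul, LinearMap.adjoint_inner_right, inner_sub_left]
    ring_nf
  rw [Real.fourier_eq, Real.fourier_eq]
  simp_rw [hphase]
  rw [integral_comp_linearMap_sub volume hA v fun y =>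
    Real.fourierChar (-inner ℝ v η) • Real.fourierChar (-inner ℝ y η) • f y]
  simp_rw [Circle.smul_def]
  rw [integral_smul]

variable [CompleteSpace F]

theorem coeFn_fourier_Lp_two_ae_eq (f : Lp F 2 (volume : Measure E)) (hf : Integrable f) :
    (𝓕 f : Lp F 2 (volume : Measure E)) =ᵐ[volume] 𝓕 (f : E → F) := by
  have hcont : Continuous (𝓕 (f : E → F)) :=
    VectorFourier.fourierIntegral_continuous Real.continuous_fourierChar
      (by exact continuous_inner) hf
  refine (sub_ae_eq_zero _ _).1 (ae_eq_zero_of_integral_contDiff_smul_eq_zero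
    (((Lp.memLp _).locallyIntegrable (by norm_num)).sub hcont.locallyIntegrable) ?_)
  intro φ hφ hφc
  have hsupp : HasCompactSupport (Complex.ofRealCLM ∘ φ) := hφc.comp_left rfl
  let u := hsupp.toSchwartzMap (Complex.ofRealCLM.contDiff.comp hφ)
  have hdistr : ∫ x, (𝓕 u) x • f x = ∫ x, u x • (𝓕 f : Lp F 2 (volume : Measure E)) x := by
    simpa only [TemperedDistribution.fourier_apply, Lp.toTemperedDistribution_apply] using
      congrArg (fun T => T u) (Lp.fourier_toTemperedDistribution_eq f)
  have hflip := VectorFourier.integral_fourierIntegral_smul_eq_flip (μ := (volume : Measure E))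
    (ν := (volume : Measure E)) (L := innerₗ E) (f := u) (g := f)
    Real.continuous_fourierChar (by exact continuous_inner) u.integrable hf
  rw [flip_innerₗ] at hflip
  have hint : Integrable fun x => u x • (𝓕 f : Lp F 2 (volume : Measure E)) x :=
    memLp_one_iff_integrable.1
      ((Lp.memLp (𝓕 f : Lp F 2 (volume : Measure E))).smul (u.memLp 2 volume))
  have hint' : Integrable fun x => u x • 𝓕 (f : E → F) x :=
    (u.continuous.smul hcont).integrable_of_hasCompactSupport hsupp.smul_right
  calc ∫ x, φ x • ((𝓕 f : Lp F 2 (volume : Measure E)) x - 𝓕 (f : E → F) x)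
      = ∫ x, (u x • (𝓕 f : Lp F 2 (volume : Measure E)) x - u x • 𝓕 (f : E → F) x) :=
        integral_congr_ae (ae_of_all _ fun x => by
          simp only [← smul_sub]; exact (Complex.coe_smul (φ x) _).symm)
    _ = 0 := by rw [integral_sub hint hint', ← hdistr, sub_eq_zero]; exact hflip

theorem exists_fourier_ae_eq_of_memSobolev {β : ℝ} (hβ : 0 ≤ β)
    {g : Lp F 2 (volume : Measure E)}
    (hg : TemperedDistribution.MemSobolev β 2 (Lp.toTemperedDistribution g)) :
    ∃ h : Lp F 2 (volume : Measure E),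
      ∀ᵐ ξ, (𝓕 g : Lp F 2 (volume : Measure E)) ξ =
        (((1 + ‖ξ‖ ^ 2) ^ (-(β / 2)) : ℝ) : ℂ) • h ξ := by
  obtain ⟨h, hh⟩ := TemperedDistribution.memSobolev_iff_exists_smulLeftCLM_fourier.1 hg
  refine ⟨h, ?_⟩
  let w : E → ℂ := fun ξ => (((1 + ‖ξ‖ ^ 2) ^ (-(β / 2)) : ℝ) : ℂ)
  have hwt : w.HasTemperateGrowth := by fun_prop
  have hwm : MemLp w ∞ (volume : Measure E) := by
    refine memLp_top_of_bound hwt.1.continuous.aestronglyMeasurable 1 (ae_of_all _ fun ξ => ?_)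
    rw [Complex.norm_real, Real.norm_of_nonneg (by positivity)]
    exact Real.rpow_le_one_of_one_le_of_nonpos (le_add_of_nonneg_right (sq_nonneg _)) (by linarith)
  have hinv : ((fun ξ : E ↦ (((1 + ‖ξ‖ ^ 2) ^ (β / 2) : ℝ) : ℂ)) * w) = fun _ => 1 := by
    ext ξ
    rw [Pi.mul_apply, ← Complex.ofReal_mul, ← Real.rpow_add (by positivity), add_neg_cancel,
      Real.rpow_zero, Complex.ofReal_one]
  have hdistr := Lp.toTemperedDistribution_smul_eq (r := 2) hwt hwm h
  rw [← hh, TemperedDistribution.smulLeftCLM_smulLeftCLM_apply (by fun_prop) hwt, hinv,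
    TemperedDistribution.smulLeftCLM_const, one_smul,
    Lp.fourier_toTemperedDistribution_eq] at hdistr
  have hfun := LinearMap.ker_eq_bot.1
    (Lp.ker_toTemperedDistributionCLM_eq_bot (μ := (volume : Measure E)) (F := F) (p := 2)) hdistr
  filter_upwards [Lp.coeFn_lpSMul (r := 2) (hwm.toLp w) h, hwm.coeFn_toLp] with ξ h₁ h₂
  rw [← hfun, h₁, Pi.smul_apply', h₂]

theorem integral_inner_comp_linearMap_sub (hA : LinearMap.det A ≠ 0) (v : E)
    (f g : Lp F 2 (volume : Measure E)) (hf : Integrable f) :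
    ∫ x, inner ℂ (f (A x - v)) (g x) =
      ∫ η, Real.fourierChar (inner ℝ v η) •
        inner ℂ ((𝓕 f : Lp F 2 (volume : Measure E)) η)
          ((𝓕 g : Lp F 2 (volume : Measure E)) (A.adjoint η)) := by
  have hA' : LinearMap.det A.adjoint ≠ 0 := by rwa [det_adjoint]
  have hmem := memLp_comp_linearMap_sub volume hA v (Lp.memLp f)
  have hint : Integrable fun x => f (A x - v) := memLp_one_iff_integrable.1
    (memLp_comp_linearMap_sub volume hA v (memLp_one_iff_integrable.2 hf))
  let k : Lp F 2 (volume : Measure E) := hmem.toLp _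
  have hk : k =ᵐ[volume] fun x => f (A x - v) := hmem.coeFn_toLp
  have hkint : Integrable k := hint.congr hk.symm
  have hadj := (quasiMeasurePreserving_linearMap_sub volume hA' 0).ae
    (coeFn_fourier_Lp_two_ae_eq k hkint)
  simp only [sub_zero] at hadj
  calc ∫ x, inner ℂ (f (A x - v)) (g x)
      = ∫ x, inner ℂ (k x) (g x) := integral_congr_ae (hk.mono fun x hx => by simp only [hx])
    _ = ∫ ξ, inner ℂ ((𝓕 k : Lp F 2 (volume : Measure E)) ξ)
          ((𝓕 g : Lp F 2 (volume : Measure E)) ξ) := by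
        rw [← L2.inner_def, ← L2.inner_def, Lp.inner_fourier_eq]
    _ = |LinearMap.det A| • ∫ η, inner ℂ ((𝓕 k : Lp F 2 (volume : Measure E)) (A.adjoint η))
          ((𝓕 g : Lp F 2 (volume : Measure E)) (A.adjoint η)) := by
        have hsubst := integral_comp_linearMap_sub volume hA' 0 fun ξ =>
          inner ℂ ((𝓕 k : Lp F 2 (volume : Measure E)) ξ)
            ((𝓕 g : Lp F 2 (volume : Measure E)) ξ)
        simp only [sub_zero, det_adjoint] at hsubst
        rw [hsubst, smul_inv_smul₀ (abs_ne_zero.2 hA)]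
    _ = _ := by
        rw [← integral_smul]
        refine integral_congr_ae ?_
        filter_upwards [hadj, coeFn_fourier_Lp_two_ae_eq f hf] with η hη hfη
        rw [hη, hfη, Real.fourier_congr_ae hk, fourier_comp_linearMap_sub hA v, Circle.smul_def,
          Circle.smul_def, ← Complex.coe_smul |LinearMap.det A|⁻¹, inner_smul_left, inner_smul_left,
          AddChar.map_neg_eq_inv, Circle.coe_inv_eq_conj, Complex.conj_conj, Complex.conj_ofReal,
          Complex.ofReal_inv, Complex.real_smul,
          mul_inv_cancel_left₀ (Complex.ofReal_ne_zero.2 (abs_ne_zero.2 hA)), smul_eq_mul]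

end Fourier

section DecaySums

theorem tsum_nat_one_add_mul_rpow_neg_le {p τ : ℝ} (hp : 1 < p) (hτ : 0 < τ) :
    ∑' n : ℕ, ENNReal.ofReal ((1 + τ * n) ^ (-p)) ≤ ENNReal.ofReal (1 + 1 / (τ * (p - 1))) := by
  have : 0 < τ * (p - 1) := mul_pos hτ (sub_pos.2 hp)
  have hanti : ∀ N : ℕ, AntitoneOn (fun x : ℝ => (1 + τ * x) ^ (-p)) (Set.Icc 0 (0 + N)) := by
    intro N x hx y _ hxy
    exact Real.rpow_le_rpow_of_nonpos (by nlinarith [hx.1]) (by gcongr) (by linarith)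
  have hint : ∀ N : ℕ, ∫ x in (0 : ℝ)..0 + N, (1 + τ * x) ^ (-p) ≤ 1 / (τ * (p - 1)) := by
    intro N
    have hN : 0 ≤ τ * N := by positivity
    rw [intervalIntegral.integral_comp_add_mul (fun x : ℝ => x ^ (-p)) hτ.ne', integral_rpow]
    · rw [mul_zero, add_zero, zero_add, Real.one_rpow, smul_eq_mul, ← neg_div_neg_eq, neg_sub,
        inv_mul_eq_div, div_div, show -(-p + 1) * τ = τ * (p - 1) by ring]
      gcongr
      exact sub_le_self _ (by positivity)
    · refine .inr ⟨by linarith, ?_⟩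
      rw [Set.uIcc_of_le (by linarith)]
      exact fun h => by linarith [h.1]
  refine ENNReal.tsum_le_of_sum_range_le fun N => ?_
  calc ∑ n ∈ Finset.range N, ENNReal.ofReal ((1 + τ * n) ^ (-p))
      ≤ ∑ n ∈ Finset.range (N + 1), ENNReal.ofReal ((1 + τ * n) ^ (-p)) :=
        Finset.sum_le_sum_of_subset (Finset.range_mono N.le_succ)
    _ = ENNReal.ofReal (∑ n ∈ Finset.range (N + 1), (1 + τ * n) ^ (-p)) :=
        (ENNReal.ofReal_sum_of_nonneg fun _ _ => by positivity).symm
    _ ≤ ENNReal.ofReal (1 + 1 / (τ * (p - 1))) := by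
        refine ENNReal.ofReal_le_ofReal ?_
        have hsum := (hanti N).sum_le_integral.trans (hint N)
        rw [Finset.sum_range_succ', Nat.cast_zero, mul_zero, add_zero, Real.one_rpow]
        simp only [zero_add] at hsum
        linarith

theorem tsum_int_one_add_abs_sub_mul_rpow_neg_le {p t : ℝ} (hp : 1 < p) (ht : t ≠ 0) (a : ℝ) :
    ∑' k : ℤ, ENNReal.ofReal ((1 + |a - k * t|) ^ (-p)) ≤
      2 * ENNReal.ofReal (1 + 1 / (|t| * (p - 1))) := by
  let f : ℤ → ℝ≥0∞ := fun k => ENNReal.ofReal ((1 + |a - k * t|) ^ (-p))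
  let k₀ : ℤ := ⌊a / t⌋ + 1
  have hlow : (⌊a / t⌋ : ℝ) ≤ a / t := Int.floor_le _
  have hup : a / t < (⌊a / t⌋ : ℝ) + 1 := Int.lt_floor_add_one _
  have hterm : ∀ (k : ℤ) (n : ℕ), (n : ℝ) ≤ |a / t - k| →
      f k ≤ ENNReal.ofReal ((1 + |t| * n) ^ (-p)) := by
    intro k n hkn
    have habs : |a - k * t| = |t| * |a / t - k| := by
      rw [← abs_mul, mul_sub, mul_div_cancel₀ a ht, mul_comm]
    refine ENNReal.ofReal_le_ofReal
      (Real.rpow_le_rpow_of_nonpos (by positivity) ?_ (by linarith))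
    rw [habs]
    gcongr
  calc ∑' k, f k
      = ∑' n : ℕ, f (n + k₀) + ∑' n : ℕ, f (-(n + 1) + k₀) := by
        rw [← (Equiv.addRight k₀).tsum_eq]
        exact (HasSum.of_nat_of_neg_add_one (f := fun k => f (Equiv.addRight k₀ k))
          ENNReal.summable.hasSum ENNReal.summable.hasSum).tsum_eq
    _ ≤ ∑' n : ℕ, ENNReal.ofReal ((1 + |t| * n) ^ (-p)) +
          ∑' n : ℕ, ENNReal.ofReal ((1 + |t| * n) ^ (-p)) := by
        gcongr with n n
        · refine hterm _ _ ?_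
          rw [abs_sub_comm]
          push_cast [k₀]
          exact le_trans (by linarith) (le_abs_self _)
        · refine hterm _ _ ?_
          push_cast [k₀]
          exact le_trans (by linarith) (le_abs_self _)
    _ ≤ 2 * ENNReal.ofReal (1 + 1 / (|t| * (p - 1))) := by
        rw [← two_mul]
        gcongr
        exact tsum_nat_one_add_mul_rpow_neg_le hp (abs_pos.2 ht)

theorem tsum_geometric_mul_div_one_add_sq_le {x ρ : ℝ} (hx : 0 ≤ x) (hρ₀ : 0 ≤ ρ) (hρ₁ : ρ < 1) :
    ∑' j : ℕ, ENNReal.ofReal (ρ ^ j * x / (1 + ρ ^ j * x) ^ 2) ≤ ENNReal.ofReal (1 / (1 - ρ)) := by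
  have hρ : 0 < 1 - ρ := sub_pos.2 hρ₁
  have hstep : ∀ t : ℝ, 0 ≤ t →
      (1 - ρ) * (t / (1 + t) ^ 2) ≤ 1 / (1 + ρ * t) - 1 / (1 + t) := by
    intro t ht
    calc (1 - ρ) * (t / (1 + t) ^ 2) ≤ (1 - ρ) * (t / ((1 + ρ * t) * (1 + t))) := by
          rw [sq]
          gcongr
          exact mul_le_of_le_one_left ht hρ₁.le
      _ = 1 / (1 + ρ * t) - 1 / (1 + t) := by
          field_simp
          ring
  refine ENNReal.tsum_le_of_sum_range_le fun n => ?_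
  rw [← ENNReal.ofReal_sum_of_nonneg fun _ _ => by positivity]
  refine ENNReal.ofReal_le_ofReal ?_
  rw [le_div_iff₀' hρ, Finset.mul_sum]
  calc ∑ j ∈ Finset.range n, (1 - ρ) * (ρ ^ j * x / (1 + ρ ^ j * x) ^ 2)
      ≤ ∑ j ∈ Finset.range n, (1 / (1 + ρ ^ (j + 1) * x) - 1 / (1 + ρ ^ j * x)) := by
        refine Finset.sum_le_sum fun j _ => ?_
        have hj := hstep (ρ ^ j * x) (by positivity)
        rwa [← mul_assoc, ← pow_succ'] at hj
    _ = 1 / (1 + ρ ^ n * x) - 1 / (1 + ρ ^ 0 * x) :=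
        Finset.sum_range_sub (fun j => 1 / (1 + ρ ^ j * x)) n
    _ ≤ 1 := by
        refine (sub_le_self _ (by positivity)).trans ?_
        exact div_le_one_of_le₀ (le_add_of_nonneg_right (by positivity)) (by positivity)

end DecaySums

section ShearletWeight

/-- The weight `(|η₀| / (1 + |η₀|))^s ∏ᵢ (1 + |ηᵢ|)^(-p)`, vanishing to order `s` on the plane
`η₀ = 0` and decaying to order `p` in every coordinate. It dominates the Fourier transform of a
feasible shearlet. -/
noncomputable def shearletWeight (s p : ℝ) (η : R3) : ℝ :=
  (|η 0| / (1 + |η 0|)) ^ s * ∏ i, (1 + |η i|) ^ (-p)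

theorem shearletWeight_nonneg (s p : ℝ) (η : R3) : 0 ≤ shearletWeight s p η := by
  unfold shearletWeight
  positivity

theorem measurable_shearletWeight (s p : ℝ) : Measurable (shearletWeight s p) := by
  have happly : ∀ i : Fin 3, Measurable fun η : R3 => |η i| := fun i =>
    (by fun_prop : Continuous fun η : R3 => |η i|).measurable
  exact (((happly 0).div ((happly 0).const_add 1)).pow_const s).mul
    (Finset.measurable_fun_prod _ fun i _ => ((happly i).const_add 1).pow_const _)

theorem shearletWeight_le_prod {s : ℝ} (hs : 0 ≤ s) (p : ℝ) (η : R3) :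
    shearletWeight s p η ≤ ∏ i, (1 + |η i|) ^ (-p) :=
  mul_le_of_le_one_left (by positivity) (Real.rpow_le_one (by positivity)
    (div_le_one_of_le₀ (by linarith) (by positivity)) hs)

-- For `ε ≤ p` the loss `((1 + t) / t) ^ 2` from the two sums over shears leaves
-- `t ^ ε * (1 + t) ^ (-2 * ε)`, which is comparable with `y / (1 + y) ^ 2` for `y = t ^ ε`.
theorem div_one_add_rpow_mul_rpow_neg_le {ε p t : ℝ} (hε : 0 ≤ ε) (hεp : ε ≤ p) (ht : 0 < t) :
    (t / (1 + t)) ^ (2 + ε) * (1 + t) ^ (-p) * (1 + 1 / t) ^ 2 ≤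
      4 * (t ^ ε / (1 + t ^ ε) ^ 2) := by
  have hsum : 1 + t ^ ε ≤ 2 * (1 + t) ^ ε := by
    have h₁ : 1 ≤ (1 + t) ^ ε := Real.one_le_rpow (by linarith) hε
    have h₂ : t ^ ε ≤ (1 + t) ^ ε := by gcongr; linarith
    linarith
  calc (t / (1 + t)) ^ (2 + ε) * (1 + t) ^ (-p) * (1 + 1 / t) ^ 2
      = t ^ ε / (1 + t) ^ ε * (1 + t) ^ (-p) := by
        rw [Real.rpow_add (by positivity), Real.rpow_two, Real.div_rpow ht.le (by positivity) ε]
        field_simp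
        ring
    _ ≤ t ^ ε / (1 + t) ^ ε * (1 + t) ^ (-ε) := by
        gcongr
        linarith
    _ = 4 * (t ^ ε / (2 * (1 + t) ^ ε) ^ 2) := by
        rw [Real.rpow_neg (by positivity)]
        field_simp
        ring
    _ ≤ 4 * (t ^ ε / (1 + t ^ ε) ^ 2) := by gcongr

theorem tsum_shear_shearletWeight_le {ε p t : ℝ} (hε : 0 ≤ ε) (hp : 1 < p) (hεp : ε ≤ p)
    (ht : t ≠ 0) (y z : ℝ) :
    ∑' k : ℤ × ℤ, ENNReal.ofReal (shearletWeight (2 + ε) p !₂[t, y - k.1 * t, z - k.2 * t]) ≤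
      ENNReal.ofReal (4 * (2 + 2 / (p - 1)) ^ 2) *
        ENNReal.ofReal (|t| ^ ε / (1 + |t| ^ ε) ^ 2) := by
  have ht' : 0 < |t| := abs_pos.2 ht
  have hp' : 0 < p - 1 := sub_pos.2 hp
  have hline : ∀ a : ℝ, ∑' k : ℤ, ENNReal.ofReal ((1 + |a - k * t|) ^ (-p)) ≤
      ENNReal.ofReal ((2 + 2 / (p - 1)) * (1 + 1 / |t|)) := by
    intro a
    refine (tsum_int_one_add_abs_sub_mul_rpow_neg_le hp ht a).trans ?_
    rw [← ENNReal.ofReal_ofNat, ← ENNReal.ofReal_mul zero_le_two]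
    refine ENNReal.ofReal_le_ofReal ?_
    have hsplit : (2 + 2 / (p - 1)) * (1 + 1 / |t|) =
        2 * (1 + 1 / (|t| * (p - 1))) + (2 / (p - 1) + 2 / |t|) := by
      field_simp
      ring
    rw [hsplit]
    exact le_add_of_nonneg_right (by positivity)
  have hfactor : ∀ k : ℤ × ℤ,
      ENNReal.ofReal (shearletWeight (2 + ε) p !₂[t, y - k.1 * t, z - k.2 * t]) =
        ENNReal.ofReal ((|t| / (1 + |t|)) ^ (2 + ε) * (1 + |t|) ^ (-p)) *
          (ENNReal.ofReal ((1 + |y - k.1 * t|) ^ (-p)) *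
            ENNReal.ofReal ((1 + |z - k.2 * t|) ^ (-p))) := by
    intro k
    rw [← ENNReal.ofReal_mul (by positivity), ← ENNReal.ofReal_mul (by positivity)]
    simp only [shearletWeight, Fin.prod_univ_three, Matrix.cons_val_zero,
      Matrix.cons_val_one, Matrix.cons_val, mul_assoc]
  calc ∑' k : ℤ × ℤ, ENNReal.ofReal (shearletWeight (2 + ε) p !₂[t, y - k.1 * t, z - k.2 * t])
      = ENNReal.ofReal ((|t| / (1 + |t|)) ^ (2 + ε) * (1 + |t|) ^ (-p)) *
          ((∑' k : ℤ, ENNReal.ofReal ((1 + |y - k * t|) ^ (-p))) *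
            ∑' k : ℤ, ENNReal.ofReal ((1 + |z - k * t|) ^ (-p))) := by
        simp_rw [hfactor, ENNReal.tsum_mul_left,
          ENNReal.tsum_prod (f := fun a b : ℤ => ENNReal.ofReal ((1 + |y - a * t|) ^ (-p)) *
            ENNReal.ofReal ((1 + |z - b * t|) ^ (-p))), ENNReal.tsum_mul_left,
          ENNReal.tsum_mul_right]
    _ ≤ ENNReal.ofReal ((|t| / (1 + |t|)) ^ (2 + ε) * (1 + |t|) ^ (-p)) *
          (ENNReal.ofReal ((2 + 2 / (p - 1)) * (1 + 1 / |t|)) *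
            ENNReal.ofReal ((2 + 2 / (p - 1)) * (1 + 1 / |t|))) := by
        gcongr <;> exact hline _
    _ = ENNReal.ofReal ((2 + 2 / (p - 1)) ^ 2 *
          ((|t| / (1 + |t|)) ^ (2 + ε) * (1 + |t|) ^ (-p) * (1 + 1 / |t|) ^ 2)) := by
        rw [← ENNReal.ofReal_mul (by positivity), ← ENNReal.ofReal_mul (by positivity)]
        ring_nf
    _ ≤ ENNReal.ofReal ((2 + 2 / (p - 1)) ^ 2 * (4 * (|t| ^ ε / (1 + |t| ^ ε) ^ 2))) := by
        gcongr ENNReal.ofReal (_ * ?_)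
        exact div_one_add_rpow_mul_rpow_neg_le hε hεp ht'
    _ = _ := by
        rw [← ENNReal.ofReal_mul (by positivity)]
        ring_nf

theorem exists_tsum_shearletWeight_le {ε p ρ : ℝ} (hε : 0 < ε) (hp : 1 < p) (hεp : ε ≤ p)
    (hρ₀ : 0 < ρ) (hρ₁ : ρ < 1) :
    ∃ K : ℝ, ∀ (x : ℝ) (y z : ℕ → ℝ),
      ∑' (j : ℕ) (k : ℤ × ℤ), ENNReal.ofReal (shearletWeight (2 + ε) p
        !₂[ρ ^ j * x, y j - k.1 * (ρ ^ j * x), z j - k.2 * (ρ ^ j * x)]) ≤ ENNReal.ofReal K := by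
  refine ⟨4 * (2 + 2 / (p - 1)) ^ 2 * (1 / (1 - ρ ^ ε)), fun x y z => ?_⟩
  rcases eq_or_ne x 0 with rfl | hx
  · have hs : 2 + ε ≠ 0 := by positivity
    simp [shearletWeight, Real.zero_rpow hs]
  have hpow : ∀ j : ℕ, |ρ ^ j * x| ^ ε = (ρ ^ ε) ^ j * |x| ^ ε := by
    intro j
    rw [abs_mul, abs_of_pos (pow_pos hρ₀ j), Real.mul_rpow (by positivity) (abs_nonneg x),
      Real.rpow_pow_comm hρ₀.le]
  calc ∑' (j : ℕ) (k : ℤ × ℤ), ENNReal.ofReal (shearletWeight (2 + ε) p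
        !₂[ρ ^ j * x, y j - k.1 * (ρ ^ j * x), z j - k.2 * (ρ ^ j * x)])
      ≤ ∑' j : ℕ, ENNReal.ofReal (4 * (2 + 2 / (p - 1)) ^ 2) *
          ENNReal.ofReal ((ρ ^ ε) ^ j * |x| ^ ε / (1 + (ρ ^ ε) ^ j * |x| ^ ε) ^ 2) := by
        gcongr with j
        rw [← hpow]
        exact tsum_shear_shearletWeight_le hε.le hp hεp (by positivity) _ _
    _ ≤ ENNReal.ofReal (4 * (2 + 2 / (p - 1)) ^ 2) * ENNReal.ofReal (1 / (1 - ρ ^ ε)) := by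
        rw [ENNReal.tsum_mul_left]
        gcongr
        exact tsum_geometric_mul_div_one_add_sq_le (by positivity) (by positivity)
          (Real.rpow_lt_one hρ₀.le hρ₁ hε)
    _ = _ := (ENNReal.ofReal_mul (by positivity)).symm

theorem min_one_mul_rpow_le {q δ t : ℝ} (hq : 0 < q) (hδ : 0 ≤ δ) (ht : 0 ≤ t) :
    min 1 ((q * t) ^ δ) ≤ (2 * (1 + q)) ^ δ * (t / (1 + t)) ^ δ := by
  rw [← Real.mul_rpow (by positivity) (by positivity), ← mul_div_assoc]
  rcases le_total (q * t) 1 with hqt | hqt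
  · refine (min_le_right _ _).trans (Real.rpow_le_rpow (by positivity) ?_ hδ)
    rw [le_div_iff₀ (by positivity)]
    nlinarith
  · refine (min_le_left _ _).trans (Real.one_le_rpow ?_ hδ)
    rw [le_div_iff₀ (by positivity)]
    nlinarith

theorem min_one_mul_rpow_neg_le {q γ t : ℝ} (hq : 0 < q) (hγ : 0 ≤ γ) (ht : 0 ≤ t) :
    min 1 ((q * t) ^ (-γ)) ≤ (2 * (1 + 1 / q)) ^ γ * (1 + t) ^ (-γ) := by
  rw [Real.rpow_neg (by positivity) γ, ← Real.inv_rpow (by positivity),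
    Real.rpow_neg (by positivity) γ, ← Real.inv_rpow (by positivity),
    ← Real.mul_rpow (by positivity) (by positivity), ← div_eq_mul_inv]
  rcases le_total (q * t) 1 with hqt | hqt
  · refine (min_le_left _ _).trans (Real.one_le_rpow ?_ hγ)
    have htq : t ≤ 1 / q := by rwa [le_div_iff₀' hq]
    rw [le_div_iff₀ (by positivity)]
    linarith
  · refine (min_le_right _ _).trans (Real.rpow_le_rpow (by positivity) ?_ hγ)
    have htq : 1 / q * (q * t) = t := by field_simp
    rw [inv_eq_one_div, div_le_div_iff₀ (by positivity) (by positivity)]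
    linarith

theorem IsFeasible.exists_norm_fourier_le {β γ δ s : ℝ} {ψ : L2R3} (hψ : IsFeasible δ γ ψ)
    (hβ : 0 ≤ β) (hγ : 0 ≤ γ) (hs : 0 ≤ s) (hδ : β + s ≤ δ) :
    ∃ C : ℝ, 0 ≤ C ∧ ∀ᵐ ξ : R3,
      ‖(𝓕 ψ : L2R3) ξ‖ ≤ C * (|ξ 0| ^ β * shearletWeight s γ ξ) := by
  obtain ⟨C, q, q', r, r', hq', hqq', hr, -, hr', -, hbound⟩ := hψ
  have hq := hq'.trans_le hqq'
  have hδ₀ : 0 ≤ δ := by linarith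
  have hvanish : ∀ t : ℝ, 0 ≤ t → (t / (1 + t)) ^ δ ≤ t ^ β * (t / (1 + t)) ^ s := by
    intro t ht
    have h₁ : t / (1 + t) ≤ 1 := div_le_one_of_le₀ (by linarith) (by positivity)
    calc (t / (1 + t)) ^ δ ≤ (t / (1 + t)) ^ (β + s) :=
          Real.rpow_le_rpow_of_exponent_ge' (by positivity) h₁ (by positivity) hδ
      _ = (t / (1 + t)) ^ β * (t / (1 + t)) ^ s := Real.rpow_add_of_nonneg (by positivity) hβ hs
      _ ≤ t ^ β * (t / (1 + t)) ^ s := by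
          gcongr
          exact div_le_self ht (by linarith)
  refine ⟨|C| * ((2 * (1 + q)) ^ δ * (2 * (1 + 1 / q')) ^ γ * (2 * (1 + 1 / r)) ^ γ *
    (2 * (1 + 1 / r')) ^ γ), by positivity, ?_⟩
  filter_upwards [hbound] with ξ hξ
  have habs : ∀ {a : ℝ} (i : Fin 3), 0 < a → |a * ξ i| = a * |ξ i| := fun i ha => by
    rw [abs_mul, abs_of_pos ha]
  rw [habs 0 hq, habs 0 hq', habs 1 hr, habs 2 hr'] at hξ
  calc ‖(𝓕 ψ : L2R3) ξ‖
      ≤ |C| * (min 1 ((q * |ξ 0|) ^ δ) * min 1 ((q' * |ξ 0|) ^ (-γ)) *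
          min 1 ((r * |ξ 1|) ^ (-γ)) * min 1 ((r' * |ξ 2|) ^ (-γ))) := by
        refine hξ.trans ?_
        gcongr
        exact le_abs_self C
    _ ≤ |C| * (((2 * (1 + q)) ^ δ * (|ξ 0| / (1 + |ξ 0|)) ^ δ) *
          ((2 * (1 + 1 / q')) ^ γ * (1 + |ξ 0|) ^ (-γ)) *
          ((2 * (1 + 1 / r)) ^ γ * (1 + |ξ 1|) ^ (-γ)) *
          ((2 * (1 + 1 / r')) ^ γ * (1 + |ξ 2|) ^ (-γ))) := by
        gcongr
        · exact min_one_mul_rpow_le hq hδ₀ (abs_nonneg _)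
        · exact min_one_mul_rpow_neg_le hq' hγ (abs_nonneg _)
        · exact min_one_mul_rpow_neg_le hr hγ (abs_nonneg _)
        · exact min_one_mul_rpow_neg_le hr' hγ (abs_nonneg _)
    _ ≤ |C| * (((2 * (1 + q)) ^ δ * (|ξ 0| ^ β * (|ξ 0| / (1 + |ξ 0|)) ^ s)) *
          ((2 * (1 + 1 / q')) ^ γ * (1 + |ξ 0|) ^ (-γ)) *
          ((2 * (1 + 1 / r)) ^ γ * (1 + |ξ 1|) ^ (-γ)) *
          ((2 * (1 + 1 / r')) ^ γ * (1 + |ξ 2|) ^ (-γ))) := by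
        gcongr
        exact hvanish _ (abs_nonneg _)
    _ = _ := by
        rw [shearletWeight, Fin.prod_univ_three]
        ring

end ShearletWeight

section LargeSieve

variable {ι : Type*}

/-- The half-open box `∏ᵢ [lᵢ / dᵢ, (lᵢ + 1) / dᵢ)`, a period cell of the characters
`latticeChar d m`. -/
def latticeBox (d : ι → ℝ) (l : ι → ℤ) : Set (ι → ℝ) :=
  Set.univ.pi fun i => Set.Ico ((l i : ℝ) / d i) (((l i : ℝ) + 1) / d i)

theorem iUnion_latticeBox {d : ι → ℝ} (hd : ∀ i, 0 < d i) : ⋃ l, latticeBox d l = Set.univ := by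
  refine Set.eq_univ_of_forall fun x => Set.mem_iUnion.2 ⟨fun i => ⌊d i * x i⌋, fun i _ => ?_⟩
  rw [Set.mem_Ico, div_le_iff₀' (hd i), lt_div_iff₀' (hd i)]
  exact ⟨Int.floor_le _, Int.lt_floor_add_one _⟩

theorem measurableSet_latticeBox [Countable ι] (d : ι → ℝ) (l : ι → ℤ) :
    MeasurableSet (latticeBox d l) :=
  MeasurableSet.univ_pi fun _ => measurableSet_Ico

variable [Fintype ι]

/-- The character `x ↦ e^(2πi ∑ᵢ dᵢ mᵢ xᵢ)` of `ℝ^ι`, with frequency in the lattice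
`diag(d) ℤ^ι`. -/
noncomputable def latticeChar (d : ι → ℝ) (m : ι → ℤ) (x : ι → ℝ) : ℂ :=
  Real.fourierChar (∑ i, d i * m i * x i)

theorem continuous_latticeChar (d : ι → ℝ) (m : ι → ℤ) : Continuous (latticeChar d m) :=
  continuous_subtype_val.comp (Real.continuous_fourierChar.comp (by fun_prop))

theorem latticeChar_mul_conj (d : ι → ℝ) (m n : ι → ℤ) (x : ι → ℝ) :
    latticeChar d m x * (starRingEnd ℂ) (latticeChar d n x) = latticeChar d (m - n) x := by
  have hphase : ∑ i, d i * ((m - n) i : ℤ) * x i =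
      ∑ i, d i * m i * x i + -∑ i, d i * n i * x i := by
    rw [← sub_eq_add_neg, ← Finset.sum_sub_distrib]
    refine Finset.sum_congr rfl fun i _ => ?_
    rw [Pi.sub_apply, Int.cast_sub]
    ring
  rw [latticeChar, latticeChar, latticeChar, hphase, AddChar.map_add_eq_mul,
    AddChar.map_neg_eq_inv, Circle.coe_mul, Circle.coe_inv_eq_conj]

theorem integrableOn_latticeBox {G : Type*} [NormedAddCommGroup G] {f : (ι → ℝ) → G}
    (hf : Continuous f) (d : ι → ℝ) (l : ι → ℤ) : IntegrableOn f (latticeBox d l) :=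
  (hf.continuousOn.integrableOn_compact (isCompact_univ_pi fun i =>
    isCompact_Icc (a := (l i : ℝ) / d i) (b := ((l i : ℝ) + 1) / d i))).mono_set
    (Set.pi_mono fun _ _ => Set.Ico_subset_Icc_self)

theorem setIntegral_Ico_fourierChar {d : ℝ} (hd : 0 < d) (l n : ℤ) :
    ∫ t in Set.Ico ((l : ℝ) / d) (((l : ℝ) + 1) / d), (Real.fourierChar (d * n * t) : ℂ) =
      if n = 0 then ((1 / d : ℝ) : ℂ) else 0 := by
  have hle : (l : ℝ) / d ≤ ((l : ℝ) + 1) / d := by gcongr; linarith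
  have hdℂ : (d : ℂ) ≠ 0 := Complex.ofReal_ne_zero.2 hd.ne'
  rw [integral_Ico_eq_integral_Ioo, ← integral_Ioc_eq_integral_Ioo,
    ← intervalIntegral.integral_of_le hle]
  split_ifs with hn
  · simp only [hn, Int.cast_zero, mul_zero, zero_mul, AddChar.map_zero_eq_one, Circle.coe_one,
      intervalIntegral.integral_const, ← sub_div, add_sub_cancel_left, Complex.real_smul, mul_one]
  · let ω : ℂ := 2 * Real.pi * d * n * Complex.I
    have hω : ω ≠ 0 := by
      simp [ω, hn, hdℂ, Real.pi_ne_zero]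
    have hexp : ∀ t : ℝ, (Real.fourierChar (d * n * t) : ℂ) = Complex.exp (ω * t) := by
      intro t
      rw [Real.fourierChar_apply]
      congr 1
      push_cast
      ring
    have hperiod : ω * (((l : ℝ) + 1) / d : ℝ) =
        ω * ((l : ℝ) / d : ℝ) + n * (2 * Real.pi * Complex.I) := by
      push_cast
      simp only [ω]
      field_simp
    simp_rw [hexp]
    rw [integral_exp_mul_complex hω, hperiod, Complex.exp_add, Complex.exp_int_mul_two_pi_mul_I,
      mul_one, sub_self, zero_div]

theorem setIntegral_latticeBox_latticeChar {d : ι → ℝ} (hd : ∀ i, 0 < d i) (l m : ι → ℤ) :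
    ∫ x in latticeBox d l, latticeChar d m x =
      if m = 0 then ((∏ i, 1 / d i : ℝ) : ℂ) else 0 := by
  have hprod : ∀ x : ι → ℝ, latticeChar d m x =
      ∏ i, (fun i (t : ℝ) => (Real.fourierChar (d i * m i * t) : ℂ)) i (x i) := by
    intro x
    exact map_prod (Circle.coeHom.comp Real.fourierChar.toMonoidHom)
      (fun i => Multiplicative.ofAdd (d i * m i * x i)) Finset.univ
  rw [integral_congr_ae (ae_of_all _ hprod), latticeBox, volume_pi, Measure.restrict_pi_pi,
    integral_fintype_prod_eq_prod fun i (t : ℝ) => (Real.fourierChar (d i * m i * t) : ℂ)]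
  simp_rw [setIntegral_Ico_fourierChar (hd _)]
  split_ifs with hm
  · simp only [hm, Pi.zero_apply, if_true, Complex.ofReal_prod]
  · obtain ⟨i, hi⟩ := Function.ne_iff.1 hm
    exact Finset.prod_eq_zero (Finset.mem_univ i) (if_neg hi)

theorem norm_sum_mul_latticeChar_sq (d : ι → ℝ) (S : Finset (ι → ℤ)) (b : (ι → ℤ) → ℂ)
    (x : ι → ℝ) :
    ((‖∑ m ∈ S, b m * latticeChar d m x‖ ^ 2 : ℝ) : ℂ) =
      ∑ m ∈ S, ∑ n ∈ S, b m * (starRingEnd ℂ) (b n) * latticeChar d (m - n) x := by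
  rw [Complex.ofReal_pow, ← Complex.mul_conj', map_sum, Finset.sum_mul_sum]
  refine Finset.sum_congr rfl fun m _ => Finset.sum_congr rfl fun n _ => ?_
  rw [← latticeChar_mul_conj, map_mul]
  ring

theorem setIntegral_latticeBox_norm_sum_sq {d : ι → ℝ} (hd : ∀ i, 0 < d i) (l : ι → ℤ)
    (S : Finset (ι → ℤ)) (b : (ι → ℤ) → ℂ) :
    ∫ x in latticeBox d l, ‖∑ m ∈ S, b m * latticeChar d m x‖ ^ 2 =
      (∏ i, 1 / d i) * ∑ m ∈ S, ‖b m‖ ^ 2 := by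
  have hint : ∀ m n, IntegrableOn
      (fun x => b m * (starRingEnd ℂ) (b n) * latticeChar d (m - n) x) (latticeBox d l) :=
    fun m n => integrableOn_latticeBox (continuous_const.mul (continuous_latticeChar d _)) d l
  have hdiag : ∀ m ∈ S, ∑ n ∈ S, ∫ x in latticeBox d l,
      b m * (starRingEnd ℂ) (b n) * latticeChar d (m - n) x =
        ((∏ i, 1 / d i : ℝ) : ℂ) * ((‖b m‖ ^ 2 : ℝ) : ℂ) := by
    intro m hm
    simp_rw [integral_const_mul, setIntegral_latticeBox_latticeChar hd, sub_eq_zero]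
    rw [Finset.sum_eq_single_of_mem m hm fun n _ hn => by rw [if_neg hn.symm, mul_zero],
      if_pos rfl, Complex.mul_conj', Complex.ofReal_pow, mul_comm]
  refine Complex.ofReal_injective ?_
  rw [← integral_complex_ofReal]
  simp_rw [norm_sum_mul_latticeChar_sq]
  rw [integral_finsetSum _ fun m _ => integrable_finsetSum _ fun n _ => hint m n]
  simp_rw [integral_finsetSum _ fun n _ => hint _ n]
  rw [Finset.sum_congr rfl hdiag, ← Finset.mul_sum, Complex.ofReal_mul, Complex.ofReal_sum]

theorem setLIntegral_latticeBox_enorm_sum_sq {d : ι → ℝ} (hd : ∀ i, 0 < d i) (l : ι → ℤ)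
    (S : Finset (ι → ℤ)) (b : (ι → ℤ) → ℂ) :
    ∫⁻ x in latticeBox d l, ‖∑ m ∈ S, b m * latticeChar d m x‖ₑ ^ 2 =
      ENNReal.ofReal (∏ i, 1 / d i) * ∑ m ∈ S, ‖b m‖ₑ ^ 2 := by
  have henorm : ∀ z : ℂ, ‖z‖ₑ ^ 2 = ENNReal.ofReal (‖z‖ ^ 2) := fun z => by
    rw [ENNReal.ofReal_pow (norm_nonneg z), ofReal_norm]
  have hcont : Continuous fun x => ∑ m ∈ S, b m * latticeChar d m x :=
    continuous_finsetSum _ fun m _ => continuous_const.mul (continuous_latticeChar d m)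
  have hint : IntegrableOn (fun x => ‖∑ m ∈ S, b m * latticeChar d m x‖ ^ 2) (latticeBox d l) :=
    integrableOn_latticeBox (hcont.norm.pow 2) d l
  simp_rw [henorm]
  rw [← ofReal_integral_eq_lintegral_ofReal hint (ae_of_all _ fun _ => sq_nonneg _),
    setIntegral_latticeBox_norm_sum_sq hd,
    ENNReal.ofReal_mul (Finset.prod_nonneg fun i _ => (one_div_pos.2 (hd i)).le),
    ENNReal.ofReal_sum_of_nonneg fun _ _ => sq_nonneg _]

theorem tsum_pi_prod_le {κ : Type*} (w : ι → κ → ℝ≥0∞) :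
    ∑' l : ι → κ, ∏ i, w i (l i) ≤ ∏ i, ∑' k, w i k := by
  classical
  rw [ENNReal.tsum_eq_iSup_sum]
  refine iSup_le fun S => ?_
  calc ∑ l ∈ S, ∏ i, w i (l i)
      ≤ ∑ l ∈ Fintype.piFinset fun i => S.image (· i), ∏ i, w i (l i) :=
        Finset.sum_le_sum_of_subset fun l hl =>
          Fintype.mem_piFinset.2 fun _ => Finset.mem_image_of_mem _ hl
    _ = ∏ i, ∑ k ∈ S.image (· i), w i k := (Finset.prod_univ_sum _ _).symm
    _ ≤ ∏ i, ∑' k, w i k := Finset.prod_le_prod' fun i _ => ENNReal.sum_le_tsum _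

theorem one_add_abs_rpow_neg_le_of_mem_Ico {d p x : ℝ} {l : ℤ} (hd : 0 < d) (hp : 0 ≤ p)
    (hx : x ∈ Set.Ico ((l : ℝ) / d) (((l : ℝ) + 1) / d)) :
    (1 + |x|) ^ (-p) ≤ (1 + 1 / d) ^ p * (1 + |0 - l * (1 / d)|) ^ (-p) := by
  have hd' : 0 < 1 / d := one_div_pos.2 hd
  have hcell : |0 - l * (1 / d)| ≤ |x| + 1 / d := by
    rw [Set.mem_Ico, add_div, div_eq_mul_one_div (l : ℝ)] at hx
    rw [zero_sub, abs_neg, abs_le]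
    constructor
    · linarith [neg_abs_le x, hx.1, hx.2]
    · linarith [le_abs_self x, hx.1]
  have hbase : 1 + |0 - l * (1 / d)| ≤ (1 + 1 / d) * (1 + |x|) := by
    nlinarith [mul_nonneg hd'.le (abs_nonneg x)]
  rw [Real.rpow_neg (by positivity), Real.rpow_neg (by positivity), ← div_eq_mul_inv,
    ← Real.div_rpow (by positivity) (by positivity), ← Real.inv_rpow (by positivity)]
  refine Real.rpow_le_rpow (by positivity) ?_ hp
  rwa [inv_eq_one_div, div_le_div_iff₀ (by positivity) (by positivity), one_mul]

theorem exists_lintegral_enorm_sum_latticeChar_sq_mul_le {d : ι → ℝ} (hd : ∀ i, 0 < d i) {p : ℝ}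
    (hp : 1 < p) :
    ∃ K : ℝ≥0∞, K ≠ ∞ ∧ ∀ (S : Finset (ι → ℤ)) (b : (ι → ℤ) → ℂ),
      ∫⁻ x, ‖∑ m ∈ S, b m * latticeChar d m x‖ₑ ^ 2 * ENNReal.ofReal (∏ i, (1 + |x i|) ^ (-p)) ≤
        K * ∑ m ∈ S, ‖b m‖ₑ ^ 2 := by
  let w : ι → ℤ → ℝ≥0∞ := fun i l =>
    ENNReal.ofReal ((1 + 1 / d i) ^ p * (1 + |0 - l * (1 / d i)|) ^ (-p))
  have hw : ∏ i, ∑' l, w i l ≠ ∞ := by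
    refine ENNReal.prod_ne_top fun i _ => ?_
    have hd' : 0 < 1 / d i := one_div_pos.2 (hd i)
    simp_rw [w, ENNReal.ofReal_mul (show 0 ≤ (1 + 1 / d i) ^ p by positivity)]
    rw [ENNReal.tsum_mul_left]
    exact ENNReal.mul_ne_top ENNReal.ofReal_ne_top (ne_top_of_le_ne_top
      (ENNReal.mul_ne_top ENNReal.ofNat_ne_top ENNReal.ofReal_ne_top)
      (tsum_int_one_add_abs_sub_mul_rpow_neg_le hp hd'.ne' 0))
  refine ⟨(∏ i, ∑' l, w i l) * ENNReal.ofReal (∏ i, 1 / d i),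
    ENNReal.mul_ne_top hw ENNReal.ofReal_ne_top, fun S b => ?_⟩
  let T : (ι → ℝ) → ℝ≥0∞ := fun x => ‖∑ m ∈ S, b m * latticeChar d m x‖ₑ ^ 2
  have hbox : ∀ l, ∀ x ∈ latticeBox d l,
      T x * ENNReal.ofReal (∏ i, (1 + |x i|) ^ (-p)) ≤ T x * ∏ i, w i (l i) := by
    intro l x hx
    rw [← ENNReal.ofReal_prod_of_nonneg fun i _ => by have := hd i; positivity]
    gcongr with i
    exact one_add_abs_rpow_neg_le_of_mem_Ico (hd i) (by linarith) (hx i trivial)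
  calc ∫⁻ x, T x * ENNReal.ofReal (∏ i, (1 + |x i|) ^ (-p))
      ≤ ∑' l, ∫⁻ x in latticeBox d l, T x * ENNReal.ofReal (∏ i, (1 + |x i|) ^ (-p)) := by
        rw [← setLIntegral_univ, ← iUnion_latticeBox hd]
        exact lintegral_iUnion_le _ _
    _ ≤ ∑' l, ∫⁻ x in latticeBox d l, T x * ∏ i, w i (l i) :=
        ENNReal.tsum_le_tsum fun l => setLIntegral_mono' (measurableSet_latticeBox d l) (hbox l)
    _ = ∑' l : ι → ℤ, (∏ i, w i (l i)) *
          (ENNReal.ofReal (∏ i, 1 / d i) * ∑ m ∈ S, ‖b m‖ₑ ^ 2) := by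
        refine tsum_congr fun l => ?_
        rw [lintegral_mul_const' _ _ (ENNReal.prod_ne_top fun _ _ => ENNReal.ofReal_ne_top),
          setLIntegral_latticeBox_enorm_sum_sq hd, mul_comm]
    _ ≤ _ := by
        rw [ENNReal.tsum_mul_right, ← mul_assoc]
        gcongr
        exact tsum_pi_prod_le w

end LargeSieve

section Duality

variable {X : Type*} [MeasurableSpace X] {μ : Measure X} {w u : X → ℝ≥0∞}

theorem lintegral_mul_mul_sq_le {v : X → ℝ≥0∞} (hw : AEMeasurable w μ) (hu : AEMeasurable u μ)
    (hv : AEMeasurable v μ) :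
    (∫⁻ x, u x * v x * w x ∂μ) ^ 2 ≤ (∫⁻ x, u x ^ 2 * w x ∂μ) * ∫⁻ x, v x ^ 2 * w x ∂μ := by
  have hac := withDensity_absolutelyContinuous μ w
  have hdensity : ∀ f : X → ℝ≥0∞, AEMeasurable f μ →
      ∫⁻ x, f x ∂μ.withDensity w = ∫⁻ x, f x * w x ∂μ := fun f hf => by
    rw [lintegral_withDensity_eq_lintegral_mul₀ hw hf]
    simp only [Pi.mul_apply, mul_comm]
  have hholder := ENNReal.lintegral_mul_le_Lp_mul_Lq (μ.withDensity w)
    Real.HolderConjugate.two_two (hu.mono_ac hac) (hv.mono_ac hac)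
  simp only [Pi.mul_apply, ENNReal.rpow_two] at hholder
  rw [hdensity (fun x => u x * v x) (hu.mul hv), hdensity (fun x => u x ^ 2) (hu.pow_const 2),
    hdensity (fun x => v x ^ 2) (hv.pow_const 2)] at hholder
  refine (pow_le_pow_left' hholder 2).trans_eq ?_
  rw [mul_pow, ← ENNReal.rpow_mul_natCast, ← ENNReal.rpow_mul_natCast, Nat.cast_ofNat,
    one_div_mul_cancel two_ne_zero, ENNReal.rpow_one, ENNReal.rpow_one]

variable {I : Type*} {e : I → X → ℂ} {K : ℝ≥0∞}

-- Test the large sieve inequality against the coefficients `b i = conj (∫ F * e i)`.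
theorem tsum_enorm_integral_mul_sq_le_of_largeSieve (hw : AEMeasurable w μ)
    (he : ∀ i, AEStronglyMeasurable (e i) μ)
    (hsieve : ∀ (S : Finset I) (b : I → ℂ),
      ∫⁻ x, ‖∑ i ∈ S, b i * e i x‖ₑ ^ 2 * w x ∂μ ≤ K * ∑ i ∈ S, ‖b i‖ₑ ^ 2)
    {F : X → ℂ} (hFe : ∀ i, Integrable (fun x => F x * e i x) μ) (hu : AEMeasurable u μ)
    (hF : ∀ᵐ x ∂μ, ‖F x‖ₑ ≤ u x * w x) :
    ∑' i, ‖∫ x, F x * e i x ∂μ‖ₑ ^ 2 ≤ K * ∫⁻ x, u x ^ 2 * w x ∂μ := by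
  let a : I → ℂ := fun i => ∫ x, F x * e i x ∂μ
  rw [ENNReal.tsum_eq_iSup_sum]
  refine iSup_le fun S => ?_
  let T : X → ℂ := fun x => ∑ i ∈ S, (starRingEnd ℂ) (a i) * e i x
  let A : ℝ≥0∞ := ∑ i ∈ S, ‖a i‖ₑ ^ 2
  have hT : AEMeasurable (fun x => ‖T x‖ₑ) μ :=
    (Finset.aestronglyMeasurable_fun_sum S fun i _ => (he i).const_mul _).enorm
  have hpair : ∫ x, F x * T x ∂μ = ((∑ i ∈ S, ‖a i‖ ^ 2 : ℝ) : ℂ) := by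
    simp_rw [T, Finset.mul_sum, mul_left_comm (F _)]
    rw [integral_finsetSum _ fun i _ => (hFe i).const_mul _, Complex.ofReal_sum]
    refine Finset.sum_congr rfl fun i _ => ?_
    rw [integral_const_mul, Complex.conj_mul', Complex.ofReal_pow]
  have hA : A ≤ ∫⁻ x, u x * ‖T x‖ₑ * w x ∂μ := by
    have hnorm : A = ‖∫ x, F x * T x ∂μ‖ₑ := by
      rw [hpair, ← ofReal_norm, Complex.norm_real, Real.norm_of_nonneg (by positivity),
        ENNReal.ofReal_sum_of_nonneg fun _ _ => sq_nonneg _]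
      simp_rw [A, ENNReal.ofReal_pow (norm_nonneg _), ofReal_norm]
    rw [hnorm]
    refine (enorm_integral_le_lintegral_enorm _).trans (lintegral_mono_ae (hF.mono fun x hx => ?_))
    rw [enorm_mul, mul_right_comm]
    gcongr
  have hsq : A * A ≤ (K * ∫⁻ x, u x ^ 2 * w x ∂μ) * A :=
    calc A * A ≤ (∫⁻ x, u x * ‖T x‖ₑ * w x ∂μ) ^ 2 := by rw [← sq]; gcongr
      _ ≤ (∫⁻ x, u x ^ 2 * w x ∂μ) * ∫⁻ x, ‖T x‖ₑ ^ 2 * w x ∂μ := lintegral_mul_mul_sq_le hw hu hT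
      _ ≤ (∫⁻ x, u x ^ 2 * w x ∂μ) * (K * A) := by
          gcongr
          simpa only [RCLike.enorm_conj] using hsieve S fun i => (starRingEnd ℂ) (a i)
      _ = (K * ∫⁻ x, u x ^ 2 * w x ∂μ) * A := by ring
  rcases eq_or_ne A 0 with hA₀ | hA₀
  · exact hA₀.le.trans zero_le
  · exact (ENNReal.mul_le_mul_iff_left hA₀
      (ENNReal.sum_ne_top.2 fun _ _ => ENNReal.pow_ne_top enorm_ne_top)).1 hsq

end Duality

theorem latticePoint_apply (c : ℝ × ℝ) (m : Fin 3 → ℤ) (i : Fin 3) :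
    latticePoint c m i = ![c.1, c.2, c.2] i * m i := by
  fin_cases i <;> simp [latticePoint, latticeMatrix, dotProduct, Fin.sum_univ_three]

theorem latticeChar_eq_fourierChar_inner (c : ℝ × ℝ) (m : Fin 3 → ℤ) (η : R3) :
    latticeChar ![c.1, c.2, c.2] m η.ofLp =
      Real.fourierChar (inner ℝ (latticePoint c m) η) := by
  rw [latticeChar]
  congr 2
  simp [PiLp.inner_apply, latticePoint_apply, mul_comm]

theorem exists_tsum_enorm_fourierCoeff_sq_le {c : ℝ × ℝ} (hc₁ : 0 < c.1) (hc₂ : 0 < c.2)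
    {s p : ℝ} (hs : 0 ≤ s) (hp : 1 < p) :
    ∃ K : ℝ≥0∞, K ≠ ∞ ∧ ∀ (F : R3 → ℂ) (u : R3 → ℝ≥0∞), Integrable F → AEMeasurable u →
      (∀ᵐ η, ‖F η‖ₑ ≤ u η * ENNReal.ofReal (shearletWeight s p η)) →
      ∑' m, ‖∫ η, Real.fourierChar (inner ℝ (latticePoint c m) η) • F η‖ₑ ^ 2 ≤
        K * ∫⁻ η, u η ^ 2 * ENNReal.ofReal (shearletWeight s p η) := by
  have hd : ∀ i, 0 < (![c.1, c.2, c.2] : Fin 3 → ℝ) i := by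
    intro i
    fin_cases i <;> assumption
  obtain ⟨K, hK, hsieve⟩ := exists_lintegral_enorm_sum_latticeChar_sq_mul_le hd hp
  refine ⟨K, hK, fun F u hF hu hFu => ?_⟩
  let e : (Fin 3 → ℤ) → R3 → ℂ := fun m η => latticeChar ![c.1, c.2, c.2] m η.ofLp
  have he : ∀ m, AEStronglyMeasurable (e m) volume := fun m =>
    ((continuous_latticeChar _ m).comp (PiLp.continuous_ofLp 2 _)).aestronglyMeasurable
  have hbdd : ∀ m, ∀ᵐ η, ‖e m η‖ ≤ 1 := fun m => ae_of_all _ fun η => (Circle.norm_coe _).le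
  have hcoeff : ∀ m, ∫ η, Real.fourierChar (inner ℝ (latticePoint c m) η) • F η =
      ∫ η, F η * e m η := by
    intro m
    simp only [e, latticeChar_eq_fourierChar_inner, Circle.smul_def, smul_eq_mul, mul_comm]
  simp_rw [hcoeff]
  refine tsum_enorm_integral_mul_sq_le_of_largeSieve
    (measurable_shearletWeight s p).ennreal_ofReal.aemeasurable he (fun S b => ?_)
    (fun m => hF.mul_bdd (he m) (hbdd m)) hu hFu
  refine le_trans ?_ (hsieve S b)
  rw [← (PiLp.volume_preserving_ofLp (Fin 3)).lintegral_comp_emb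
    (MeasurableEquiv.toLp 2 (Fin 3 → ℝ)).symm.measurableEmbedding]
  gcongr with η
  exact shearletWeight_le_prod hs p η

section Shearlet

variable {α β : ℝ} {c : ℝ × ℝ} {ψ g h : L2R3} {j : ℕ} {k : ℤ × ℤ}

/-- The linear map `x ↦ S_k A_{2^j} x` of `ℝ³`. -/
noncomputable def shearScaling (α : ℝ) (j : ℕ) (k : ℤ × ℤ) : R3 →ₗ[ℝ] R3 :=
  Matrix.toLpLin 2 2 (shearMatrix k * scalingMatrix α j)

theorem shearScaling_apply (α : ℝ) (j : ℕ) (k : ℤ × ℤ) (x : R3) :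
    shearScaling α j k x =
      !₂[(2 : ℝ) ^ (j * α / 2) * x 0 + k.1 * (2 : ℝ) ^ ((j : ℝ) / 2) * x 1 +
          k.2 * (2 : ℝ) ^ ((j : ℝ) / 2) * x 2,
        (2 : ℝ) ^ ((j : ℝ) / 2) * x 1, (2 : ℝ) ^ ((j : ℝ) / 2) * x 2] := by
  ext i
  fin_cases i <;>
    simp [shearScaling, Matrix.toLpLin_apply, shearMatrix, scalingMatrix, dotProduct,
      Fin.sum_univ_three]

theorem adjoint_shearScaling_apply (α : ℝ) (j : ℕ) (k : ℤ × ℤ) (η : R3) :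
    (shearScaling α j k).adjoint η =
      !₂[(2 : ℝ) ^ (j * α / 2) * η 0, (2 : ℝ) ^ ((j : ℝ) / 2) * (k.1 * η 0 + η 1),
        (2 : ℝ) ^ ((j : ℝ) / 2) * (k.2 * η 0 + η 2)] := by
  refine ext_inner_left ℝ fun x => ?_
  rw [LinearMap.adjoint_inner_right, shearScaling_apply]
  simp only [PiLp.inner_apply, Fin.sum_univ_three, RCLike.inner_apply, conj_trivial,
    Matrix.cons_val]
  ring

theorem det_shearScaling (α : ℝ) (j : ℕ) (k : ℤ × ℤ) :
    LinearMap.det (shearScaling α j k) = (2 : ℝ) ^ ((j : ℝ) * (α + 2) / 2) := by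
  rw [shearScaling, LinearMap.det_toLpLin, Matrix.det_mul, shearMatrix, scalingMatrix,
    Matrix.det_fin_three, Matrix.det_fin_three]
  simp only [Matrix.of_apply, Matrix.cons_val, mul_zero, zero_mul, sub_zero, add_zero, mul_one]
  rw [one_mul, ← Real.rpow_add two_pos, ← Real.rpow_add two_pos]
  congr 1
  ring

theorem det_shearScaling_pos (α : ℝ) (j : ℕ) (k : ℤ × ℤ) :
    0 < LinearMap.det (shearScaling α j k) := by
  rw [det_shearScaling]
  positivity

/-- The inverse of the adjoint of `shearScaling α j k`, that is `ξ ↦ (S_k A_{2^j})⁻ᵀ ξ`. -/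
noncomputable def shearFrequency (α : ℝ) (j : ℕ) (k : ℤ × ℤ) (ξ : R3) : R3 :=
  !₂[((2 : ℝ) ^ (-(α / 2))) ^ j * ξ 0,
    ξ 1 / (2 : ℝ) ^ ((j : ℝ) / 2) - k.1 * (((2 : ℝ) ^ (-(α / 2))) ^ j * ξ 0),
    ξ 2 / (2 : ℝ) ^ ((j : ℝ) / 2) - k.2 * (((2 : ℝ) ^ (-(α / 2))) ^ j * ξ 0)]

theorem measurable_shearFrequency (α : ℝ) (j : ℕ) (k : ℤ × ℤ) :
    Measurable (shearFrequency α j k) := by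
  refine ((PiLp.continuous_toLp 2 _).comp (continuous_pi fun i => ?_)).measurable
  fin_cases i <;> simp only [Fin.reduceFinMk, Matrix.cons_val] <;> fun_prop

theorem shearFrequency_adjoint_shearScaling (α : ℝ) (j : ℕ) (k : ℤ × ℤ) (η : R3) :
    shearFrequency α j k ((shearScaling α j k).adjoint η) = η := by
  have hb : (2 : ℝ) ^ ((j : ℝ) / 2) ≠ 0 := by positivity
  have hcancel : ((2 : ℝ) ^ (-(α / 2))) ^ j * ((2 : ℝ) ^ (j * α / 2) * η 0) = η 0 := by
    rw [← mul_assoc, ← Real.rpow_mul_natCast two_pos.le, ← Real.rpow_add two_pos,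
      show -(α / 2) * j + j * α / 2 = 0 by ring, Real.rpow_zero, one_mul]
  rw [adjoint_shearScaling_apply]
  ext i
  fin_cases i
  · simpa [shearFrequency] using hcancel
  · simp [shearFrequency, hcancel, hb]
  · simp [shearFrequency, hcancel, hb]

theorem integral_mul_conj_shearlet (hψ : Integrable ψ) (α : ℝ) (c : ℝ × ℝ) (g : L2R3) (j : ℕ)
    (k : ℤ × ℤ) (m : Fin 3 → ℤ) :
    ∫ x : R3, g x * (starRingEnd ℂ) (shearlet α c ψ j k m x) =
      ((2 : ℝ) ^ (j * (α + 2) / 4) : ℝ) *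
        ∫ η, Real.fourierChar (inner ℝ (latticePoint c m) η) •
          inner ℂ ((𝓕 ψ : L2R3) η) ((𝓕 g : L2R3) ((shearScaling α j k).adjoint η)) := by
  rw [← integral_inner_comp_linearMap_sub (det_shearScaling_pos α j k).ne' _ ψ g hψ,
    ← integral_const_mul]
  refine integral_congr_ae (ae_of_all _ fun x => ?_)
  simp only [shearlet, map_mul, Complex.conj_ofReal, RCLike.inner_apply]
  rw [mul_left_comm]
  rfl

theorem enorm_integral_mul_conj_shearlet_sq (hψ : Integrable ψ) (α : ℝ) (c : ℝ × ℝ) (g : L2R3)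
    (j : ℕ) (k : ℤ × ℤ) (m : Fin 3 → ℤ) :
    ‖∫ x : R3, g x * (starRingEnd ℂ) (shearlet α c ψ j k m x)‖ₑ ^ 2 =
      ENNReal.ofReal (LinearMap.det (shearScaling α j k)) *
        ‖∫ η, Real.fourierChar (inner ℝ (latticePoint c m) η) •
          inner ℂ ((𝓕 ψ : L2R3) η) ((𝓕 g : L2R3) ((shearScaling α j k).adjoint η))‖ₑ ^ 2 := by
  rw [integral_mul_conj_shearlet hψ, enorm_mul, mul_pow, ← ofReal_norm (((_ : ℝ) : ℂ)),
    Complex.norm_real, Real.norm_of_nonneg (by positivity), ← ENNReal.ofReal_pow (by positivity),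
    det_shearScaling, ← Real.rpow_mul_natCast two_pos.le]
  congr 3
  push_cast
  ring

theorem abs_apply_rpow_mul_one_add_norm_sq_rpow_le {ι : Type*} [Fintype ι] (hβ : 0 ≤ β)
    (ξ : EuclideanSpace ℝ ι) (i : ι) : |ξ i| ^ β * (1 + ‖ξ‖ ^ 2) ^ (-(β / 2)) ≤ 1 := by
  have hi : |ξ i| ^ 2 ≤ 1 + ‖ξ‖ ^ 2 := by
    have hnorm : |ξ i| ^ 2 ≤ ‖ξ‖ ^ 2 :=
      pow_le_pow_left₀ (abs_nonneg _) (PiLp.norm_apply_le ξ i) 2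
    linarith
  have hpow : |ξ i| ^ β ≤ (1 + ‖ξ‖ ^ 2) ^ (β / 2) := by
    calc |ξ i| ^ β = (|ξ i| ^ 2) ^ (β / 2) := by
          rw [← Real.rpow_natCast_mul (abs_nonneg _), Nat.cast_ofNat, mul_div_cancel₀ β two_ne_zero]
      _ ≤ _ := Real.rpow_le_rpow (by positivity) hi (by positivity)
  rw [Real.rpow_neg (by positivity)]
  exact mul_inv_le_one_of_le₀ hpow (by positivity)

theorem norm_inner_le_of_norm_le_shearletWeight {C s p : ℝ} {z v y : ℂ} {η : R3} (hβ : 0 ≤ β)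
    (hC : 0 ≤ C) (hz : ‖z‖ ≤ C * (|η 0| ^ β * shearletWeight s p η))
    (hv : v = (((1 + ‖(shearScaling α j k).adjoint η‖ ^ 2) ^ (-(β / 2)) : ℝ) : ℂ) • y) :
    ‖(inner ℂ z v : ℂ)‖ ≤
      C * (2 : ℝ) ^ (-(j * α * β / 2)) * ‖y‖ * shearletWeight s p η := by
  let ξ := (shearScaling α j k).adjoint η
  have hξ : ξ 0 = (2 : ℝ) ^ (j * α / 2) * η 0 := by
    simp only [ξ, adjoint_shearScaling_apply, Matrix.cons_val_zero]
  have hη : |η 0| ^ β = (2 : ℝ) ^ (-(j * α * β / 2)) * |ξ 0| ^ β := by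
    rw [hξ, abs_mul, abs_of_pos (Real.rpow_pos_of_pos two_pos _),
      Real.mul_rpow (by positivity) (abs_nonneg _), ← Real.rpow_mul two_pos.le, ← mul_assoc,
      ← Real.rpow_add two_pos, show -(j * α * β / 2) + j * α / 2 * β = 0 by ring,
      Real.rpow_zero, one_mul]
  have hw := shearletWeight_nonneg s p η
  calc ‖(inner ℂ z v : ℂ)‖ ≤ ‖z‖ * ‖v‖ := norm_inner_le_norm z v
    _ ≤ C * (|η 0| ^ β * shearletWeight s p η) * ((1 + ‖ξ‖ ^ 2) ^ (-(β / 2)) * ‖y‖) := by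
        rw [hv, norm_smul, Complex.norm_real, Real.norm_of_nonneg (by positivity)]
        gcongr
    _ = C * (2 : ℝ) ^ (-(j * α * β / 2)) * ‖y‖ * shearletWeight s p η *
          (|ξ 0| ^ β * (1 + ‖ξ‖ ^ 2) ^ (-(β / 2))) := by
        rw [hη]
        ring
    _ ≤ C * (2 : ℝ) ^ (-(j * α * β / 2)) * ‖y‖ * shearletWeight s p η :=
        mul_le_of_le_one_right (by positivity)
          (abs_apply_rpow_mul_one_add_norm_sq_rpow_le hβ ξ 0)

theorem lintegral_comp_adjoint_shearScaling_mul (f w : R3 → ℝ≥0∞) (α : ℝ) (j : ℕ) (k : ℤ × ℤ) :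
    ∫⁻ η, f ((shearScaling α j k).adjoint η) * w η =
      ENNReal.ofReal (LinearMap.det (shearScaling α j k))⁻¹ *
        ∫⁻ ξ, f ξ * w (shearFrequency α j k ξ) := by
  have hdet := det_shearScaling_pos α j k
  have hadj : LinearMap.det (shearScaling α j k).adjoint = LinearMap.det (shearScaling α j k) :=
    det_adjoint _
  have hchange := lintegral_comp_linearMap_sub volume (hadj ▸ hdet.ne') 0
    fun ξ => f ξ * w (shearFrequency α j k ξ)
  simp only [sub_zero, shearFrequency_adjoint_shearScaling] at hchange
  rw [hchange, hadj, abs_of_pos hdet]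

theorem integrable_inner_comp_adjoint_shearScaling (f g : L2R3) (α : ℝ) (j : ℕ) (k : ℤ × ℤ) :
    Integrable fun η => (inner ℂ (f η) (g ((shearScaling α j k).adjoint η)) : ℂ) := by
  have hdet : LinearMap.det (shearScaling α j k).adjoint ≠ 0 := by
    rw [det_adjoint]
    exact (det_shearScaling_pos α j k).ne'
  have hmem := memLp_comp_linearMap_sub volume hdet 0 (Lp.memLp g)
  simp only [sub_zero] at hmem
  exact hmem.integrable_mul (Lp.memLp f).star

theorem exists_tsum_enorm_shearlet_sq_le {s p C : ℝ} (hc₁ : 0 < c.1) (hc₂ : 0 < c.2) (hβ : 0 ≤ β)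
    (hs : 0 ≤ s) (hp : 1 < p) (hC : 0 ≤ C) (hψint : Integrable ψ)
    (hψ : ∀ᵐ ξ, ‖(𝓕 ψ : L2R3) ξ‖ ≤ C * (|ξ 0| ^ β * shearletWeight s p ξ))
    (hg : ∀ᵐ ξ, (𝓕 g : L2R3) ξ = (((1 + ‖ξ‖ ^ 2) ^ (-(β / 2)) : ℝ) : ℂ) • h ξ) (α : ℝ) :
    ∃ K : ℝ≥0∞, K ≠ ∞ ∧ ∀ (j : ℕ) (k : ℤ × ℤ), ENNReal.ofReal ((2 : ℝ) ^ (j * α * β)) *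
        ∑' m, ‖∫ x : R3, g x * (starRingEnd ℂ) (shearlet α c ψ j k m x)‖ₑ ^ 2 ≤
      K * ∫⁻ ξ, ‖h ξ‖ₑ ^ 2 * ENNReal.ofReal (shearletWeight s p (shearFrequency α j k ξ)) := by
  obtain ⟨K, hK, hsieve⟩ := exists_tsum_enorm_fourierCoeff_sq_le hc₁ hc₂ hs hp
  refine ⟨K * ENNReal.ofReal (C ^ 2), ENNReal.mul_ne_top hK ENNReal.ofReal_ne_top, fun j k => ?_⟩
  let A := shearScaling α j k
  have hA : 0 < LinearMap.det A := det_shearScaling_pos α j k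
  have hqmp : Measure.QuasiMeasurePreserving A.adjoint volume volume := by
    have hqmp := quasiMeasurePreserving_linearMap_sub volume ((det_adjoint A).symm ▸ hA.ne') 0
    simp only [sub_zero] at hqmp
    exact hqmp
  let B : ℝ := C * (2 : ℝ) ^ (-(j * α * β / 2))
  have hbound : ∀ᵐ η, ‖(inner ℂ ((𝓕 ψ : L2R3) η) ((𝓕 g : L2R3) (A.adjoint η)) : ℂ)‖ₑ ≤
      ENNReal.ofReal B * ‖h (A.adjoint η)‖ₑ * ENNReal.ofReal (shearletWeight s p η) := by
    filter_upwards [hψ, hqmp.ae hg] with η hψη hgη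
    rw [← ofReal_norm, ← ofReal_norm, ← ENNReal.ofReal_mul (by positivity),
      ← ENNReal.ofReal_mul (by positivity)]
    exact ENNReal.ofReal_le_ofReal (norm_inner_le_of_norm_le_shearletWeight hβ hC hψη hgη)
  have hscale : ENNReal.ofReal ((2 : ℝ) ^ (j * α * β)) * (ENNReal.ofReal (LinearMap.det A) *
      (ENNReal.ofReal B ^ 2 * ENNReal.ofReal (LinearMap.det A)⁻¹)) = ENNReal.ofReal (C ^ 2) := by
    have hpow : (2 : ℝ) ^ (j * α * β) * ((2 : ℝ) ^ (-(j * α * β / 2))) ^ 2 = 1 := by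
      rw [← Real.rpow_mul_natCast two_pos.le, ← Real.rpow_add two_pos, Nat.cast_ofNat,
        show j * α * β + -(j * α * β / 2) * 2 = 0 by ring, Real.rpow_zero]
    rw [← ENNReal.ofReal_pow (by positivity), ← ENNReal.ofReal_mul (by positivity),
      ← ENNReal.ofReal_mul hA.le, ← ENNReal.ofReal_mul (by positivity)]
    congr 1
    calc _ = C ^ 2 * ((2 : ℝ) ^ (j * α * β) * ((2 : ℝ) ^ (-(j * α * β / 2))) ^ 2) *
          (LinearMap.det A * (LinearMap.det A)⁻¹) := by ring
      _ = C ^ 2 := by rw [hpow, mul_inv_cancel₀ hA.ne', mul_one, mul_one]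
  simp_rw [enorm_integral_mul_conj_shearlet_sq hψint, ENNReal.tsum_mul_left]
  have hmeas : AEMeasurable fun η => ENNReal.ofReal B * ‖h (A.adjoint η)‖ₑ :=
    ((Lp.aestronglyMeasurable h).comp_quasiMeasurePreserving hqmp).enorm.const_mul _
  grw [hsieve _ _ (integrable_inner_comp_adjoint_shearScaling _ _ α j k) hmeas hbound]
  simp_rw [mul_pow, mul_assoc (ENNReal.ofReal B ^ 2)]
  rw [lintegral_const_mul' _ _ (ENNReal.pow_ne_top ENNReal.ofReal_ne_top),
    lintegral_comp_adjoint_shearScaling_mul (fun ξ => ‖h ξ‖ₑ ^ 2)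
      fun η => ENNReal.ofReal (shearletWeight s p η), ← hscale]
  exact le_of_eq (by ring)

theorem tsum_lintegral_mul_shearletWeight_ne_top {ε p : ℝ} (hα : 0 < α) (hε : 0 < ε) (hp : 1 < p)
    (hεp : ε ≤ p) (h : L2R3) :
    ∑' (j : ℕ) (k : ℤ × ℤ), ∫⁻ ξ, ‖h ξ‖ₑ ^ 2 *
      ENNReal.ofReal (shearletWeight (2 + ε) p (shearFrequency α j k ξ)) ≠ ∞ := by
  obtain ⟨K, hK⟩ := exists_tsum_shearletWeight_le hε hp hεp
    (Real.rpow_pos_of_pos two_pos (-(α / 2)))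
    (Real.rpow_lt_one_of_one_lt_of_neg one_lt_two (by linarith))
  have henergy : ∫⁻ ξ, ‖h ξ‖ₑ ^ 2 ≠ ∞ := by
    have := lintegral_rpow_enorm_lt_top_of_eLpNorm_lt_top two_ne_zero ENNReal.ofNat_ne_top
      (Lp.memLp h).eLpNorm_lt_top
    simpa using this.ne
  have hmeas : ∀ j k, AEMeasurable fun ξ => ‖h ξ‖ₑ ^ 2 *
      ENNReal.ofReal (shearletWeight (2 + ε) p (shearFrequency α j k ξ)) := fun j k =>
    ((Lp.aestronglyMeasurable h).enorm.pow_const 2).mul ((measurable_shearletWeight _ _).comp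
      (measurable_shearFrequency α j k)).ennreal_ofReal.aemeasurable
  refine ne_top_of_le_ne_top (ENNReal.mul_ne_top henergy (ENNReal.ofReal_ne_top (r := K))) ?_
  simp_rw [← lintegral_tsum (hmeas _)]
  rw [← lintegral_tsum fun j => AEMeasurable.tsum (hmeas j),
    ← lintegral_mul_const' _ _ ENNReal.ofReal_ne_top]
  refine lintegral_mono fun ξ => ?_
  simp_rw [ENNReal.tsum_mul_left]
  gcongr
  exact hK (ξ 0) (fun j => ξ 1 / (2 : ℝ) ^ ((j : ℝ) / 2)) fun j => ξ 2 / (2 : ℝ) ^ ((j : ℝ) / 2)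

theorem CompactlySupported.integrable (hψ : CompactlySupported ψ) : Integrable (ψ : R3 → ℂ) := by
  obtain ⟨K, hK, hsupp⟩ := hψ
  have : IsFiniteMeasure (volume.restrict K) := isFiniteMeasure_restrict.2 hK.measure_ne_top
  have hint : IntegrableOn (ψ : R3 → ℂ) K := ((Lp.memLp ψ).restrict K).integrable one_le_two
  exact hint.integrable_of_ae_notMem_eq_zero hsupp

theorem tsum_weighted_shearletCoeff_sq_ne_top {δ γ : ℝ} (hα : 0 < α) (hc₁ : 0 < c.1)
    (hc₂ : 0 < c.2) (hβ : 0 ≤ β) (hg : InSobolev β g) (hψint : Integrable ψ)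
    (hψ : IsFeasible δ γ ψ) (hδ : 2 + β < δ) (hγ : 1 < γ) :
    ∑' l : ShearletIndex α, ENNReal.ofReal ((2 : ℝ) ^ (l.1.1 * α * β)) *
      ‖shearletCoeff α c ψ g l‖ₑ ^ 2 ≠ ∞ := by
  obtain ⟨ε, hε, hεγ, hεδ⟩ : ∃ ε > 0, ε ≤ γ ∧ β + (2 + ε) ≤ δ :=
    ⟨min (δ - β - 2) γ, lt_min (by linarith) (by linarith), min_le_right _ _,
      by linarith [min_le_left (δ - β - 2) γ]⟩
  obtain ⟨h, hgh⟩ := exists_fourier_ae_eq_of_memSobolev hβ hg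
  obtain ⟨C, hC, hCψ⟩ := hψ.exists_norm_fourier_le hβ (by linarith) (by linarith) hεδ
  obtain ⟨K, hK, hKψ⟩ := exists_tsum_enorm_shearlet_sq_le hc₁ hc₂ hβ (by linarith) hγ hC hψint hCψ
    hgh α
  let a : ℕ → ℤ × ℤ → (Fin 3 → ℤ) → ℝ≥0∞ := fun j k m => ENNReal.ofReal ((2 : ℝ) ^ (j * α * β)) *
    ‖∫ x : R3, g x * (starRingEnd ℂ) (shearlet α c ψ j k m x)‖ₑ ^ 2
  refine ne_top_of_le_ne_top (ENNReal.mul_ne_top hK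
    (tsum_lintegral_mul_shearletWeight_ne_top hα hε hγ hεγ h)) ?_
  calc ∑' l : ShearletIndex α, a l.1.1 l.1.2.1 l.1.2.2
      ≤ ∑' l : ℕ × (ℤ × ℤ) × (Fin 3 → ℤ), a l.1 l.2.1 l.2.2 :=
        ENNReal.tsum_comp_le_tsum_of_injective Subtype.val_injective _
    _ = ∑' (j) (k) (m), a j k m := by
        rw [ENNReal.tsum_prod (f := fun j (q : (ℤ × ℤ) × (Fin 3 → ℤ)) => a j q.1 q.2)]
        exact tsum_congr fun j => ENNReal.tsum_prod
    _ ≤ _ := by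
        simp_rw [← ENNReal.tsum_mul_left (a := K)]
        refine ENNReal.tsum_le_tsum fun j => ENNReal.tsum_le_tsum fun k => ?_
        rw [ENNReal.tsum_mul_left]
        exact hKψ j k

end Shearlet

section Support

variable {α : ℝ} {c : ℝ × ℝ} {ψ g : L2R3} {j : ℕ} {k : ℤ × ℤ} {m : Fin 3 → ℤ}

theorem SupportedIn.mono {f : L2R3} {K L : Set R3} (hf : SupportedIn f K) (h : K ⊆ L) :
    SupportedIn f L := by
  filter_upwards [hf] with x hx hL using hx fun hK => hL (h hK)

theorem CompactlySupported.eventually_supportedIn_closedBall {f : L2R3}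
    (hf : CompactlySupported f) :
    ∀ᶠ R : ℝ in Filter.atTop, SupportedIn f (Metric.closedBall 0 R) := by
  obtain ⟨K, hK, hfK⟩ := hf
  obtain ⟨R₀, hR₀⟩ := hK.isBounded.subset_closedBall 0
  filter_upwards [Filter.eventually_ge_atTop R₀] with R hR
  exact hfK.mono (hR₀.trans (Metric.closedBall_subset_closedBall hR))

theorem exists_mem_of_integral_shearlet_ne_zero {K L : Set R3} (hg : SupportedIn g K)
    (hψ : SupportedIn ψ L)
    (hne : ∫ x : R3, g x * (starRingEnd ℂ) (shearlet α c ψ j k m x) ≠ 0) :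
    ∃ x ∈ K, shearScaling α j k x - latticePoint c m ∈ L := by
  by_contra! hdisj
  refine hne (integral_eq_zero_of_ae ?_)
  have hψ' : ∀ᵐ x, shearScaling α j k x - latticePoint c m ∉ L →
      ψ (shearScaling α j k x - latticePoint c m) = 0 :=
    (quasiMeasurePreserving_linearMap_sub volume (det_shearScaling_pos α j k).ne' _).ae hψ
  filter_upwards [hg, hψ'] with x hgx hψx
  by_cases hx : x ∈ K
  · have hzero : shearlet α c ψ j k m x = 0 := mul_eq_zero_of_right _ (hψx (hdisj x hx))
    rw [hzero, map_zero, mul_zero, Pi.zero_apply]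
  · rw [hgx hx, zero_mul, Pi.zero_apply]

theorem abs_le_of_abs_sub_mul_le {d n y t B R : ℝ} (hd : 0 < d) (ht : 1 ≤ t)
    (hsub : |y - d * n| ≤ R) (hy : |y| ≤ B * R * t) : |n| ≤ (B + 1) * R / d * t := by
  have hR : 0 ≤ R := (abs_nonneg _).trans hsub
  rw [div_mul_eq_mul_div, le_div_iff₀ hd, ← abs_of_pos hd, ← abs_mul]
  calc |n * d| = |y - (y - d * n)| := by congr 1; ring
    _ ≤ |y| + |y - d * n| := abs_sub _ _
    _ ≤ B * R * t + R * t := add_le_add hy (hsub.trans (le_mul_of_one_le_right hR ht))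
    _ = (B + 1) * R * t := by ring

theorem one_le_two_rpow_mul_sub_one_div_two (hα : 1 ≤ α) (j : ℕ) :
    1 ≤ (2 : ℝ) ^ (j * (α - 1) / 2) :=
  Real.one_le_rpow one_le_two
    (div_nonneg (mul_nonneg j.cast_nonneg (sub_nonneg.2 hα)) zero_le_two)

theorem abs_le_two_mul_of_abs_le_ceil {n : ℤ} {s : ℝ} (hs : 1 ≤ s) (hn : |n| ≤ ⌈s⌉) :
    |(n : ℝ)| ≤ 2 * s := by
  have hn' : |(n : ℝ)| ≤ ⌈s⌉ := by exact_mod_cast hn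
  linarith [Int.ceil_lt_add_one s]

theorem abs_shearScaling_apply_zero_le {R s : ℝ} {x : R3} (hx : ∀ i, |x i| ≤ R)
    (hs : s * (2 : ℝ) ^ ((j : ℝ) / 2) = (2 : ℝ) ^ (j * α / 2)) (hk₁ : |(k.1 : ℝ)| ≤ 2 * s)
    (hk₂ : |(k.2 : ℝ)| ≤ 2 * s) :
    |shearScaling α j k x 0| ≤ 5 * R * (2 : ℝ) ^ (j * α / 2) := by
  have hshear : ∀ (n : ℤ) (i : Fin 3), |(n : ℝ)| ≤ 2 * s →
      |n * (2 : ℝ) ^ ((j : ℝ) / 2) * x i| ≤ 2 * R * (2 : ℝ) ^ (j * α / 2) := fun n i hn => by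
    have hs₀ : 0 ≤ 2 * s := (abs_nonneg _).trans hn
    calc |n * (2 : ℝ) ^ ((j : ℝ) / 2) * x i| = |(n : ℝ)| * (2 : ℝ) ^ ((j : ℝ) / 2) * |x i| := by
          rw [abs_mul, abs_mul, abs_of_pos (Real.rpow_pos_of_pos two_pos ((j : ℝ) / 2))]
      _ ≤ 2 * s * (2 : ℝ) ^ ((j : ℝ) / 2) * R := by
          gcongr
          exact hx i
      _ = 2 * R * (2 : ℝ) ^ (j * α / 2) := by
          rw [← hs]
          ring
  have hscale : |(2 : ℝ) ^ (j * α / 2) * x 0| ≤ R * (2 : ℝ) ^ (j * α / 2) := by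
    rw [abs_mul, abs_of_pos (Real.rpow_pos_of_pos two_pos _), mul_comm]
    gcongr
    exact hx 0
  simp only [shearScaling_apply, Matrix.cons_val_zero]
  linarith [abs_add_three ((2 : ℝ) ^ (j * α / 2) * x 0) (k.1 * (2 : ℝ) ^ ((j : ℝ) / 2) * x 1)
    (k.2 * (2 : ℝ) ^ ((j : ℝ) / 2) * x 2), hshear _ 1 hk₁, hshear _ 2 hk₂]

theorem abs_latticeIndex_le_of_integral_shearlet_ne_zero {R : ℝ} (hα : 1 ≤ α) (hc₁ : 0 < c.1)
    (hc₂ : 0 < c.2) (hg : SupportedIn g (Metric.closedBall 0 R))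
    (hψ : SupportedIn ψ (Metric.closedBall 0 R)) (hk₁ : |k.1| ≤ ⌈(2 : ℝ) ^ (j * (α - 1) / 2)⌉)
    (hk₂ : |k.2| ≤ ⌈(2 : ℝ) ^ (j * (α - 1) / 2)⌉)
    (hne : ∫ x : R3, g x * (starRingEnd ℂ) (shearlet α c ψ j k m x) ≠ 0) :
    |(m 0 : ℝ)| ≤ 6 * R / c.1 * (2 : ℝ) ^ (j * α / 2) ∧
      |(m 1 : ℝ)| ≤ 2 * R / c.2 * (2 : ℝ) ^ ((j : ℝ) / 2) ∧
      |(m 2 : ℝ)| ≤ 2 * R / c.2 * (2 : ℝ) ^ ((j : ℝ) / 2) := by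
  have hs := one_le_two_rpow_mul_sub_one_div_two hα j
  have ha : 1 ≤ (2 : ℝ) ^ (j * α / 2) := Real.one_le_rpow one_le_two (by positivity)
  have hb : 1 ≤ (2 : ℝ) ^ ((j : ℝ) / 2) := Real.one_le_rpow one_le_two (by positivity)
  have hsb : (2 : ℝ) ^ (j * (α - 1) / 2) * (2 : ℝ) ^ ((j : ℝ) / 2) = (2 : ℝ) ^ (j * α / 2) := by
    rw [← Real.rpow_add two_pos]
    ring_nf
  obtain ⟨x, hx, hxm⟩ := exists_mem_of_integral_shearlet_ne_zero hg hψ hne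
  rw [mem_closedBall_zero_iff] at hx hxm
  have hxi : ∀ i, |x i| ≤ R := fun i => (PiLp.norm_apply_le x i).trans hx
  have hdist : ∀ i, |shearScaling α j k x i - ![c.1, c.2, c.2] i * m i| ≤ R := fun i => by
    rw [← latticePoint_apply]
    exact (PiLp.norm_apply_le (shearScaling α j k x - latticePoint c m) i).trans hxm
  have hlong : |shearScaling α j k x 0| ≤ 5 * R * (2 : ℝ) ^ (j * α / 2) :=
    abs_shearScaling_apply_zero_le hxi hsb (abs_le_two_mul_of_abs_le_ceil hs hk₁)
      (abs_le_two_mul_of_abs_le_ceil hs hk₂)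
  have hshort : ∀ i, i ≠ 0 → |shearScaling α j k x i| ≤ 1 * R * (2 : ℝ) ^ ((j : ℝ) / 2) := by
    have hscale : ∀ i, |(2 : ℝ) ^ ((j : ℝ) / 2) * x i| ≤ 1 * R * (2 : ℝ) ^ ((j : ℝ) / 2) :=
      fun i => by
        rw [one_mul, abs_mul, abs_of_pos (Real.rpow_pos_of_pos two_pos _), mul_comm]
        gcongr
        exact hxi i
    intro i hi
    rw [shearScaling_apply]
    fin_cases i
    · exact absurd rfl hi
    · exact hscale 1
    · exact hscale 2
  refine ⟨(abs_le_of_abs_sub_mul_le hc₁ ha (hdist 0) hlong).trans_eq ?_,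
    (abs_le_of_abs_sub_mul_le hc₂ hb (hdist 1) (hshort 1 (by decide))).trans_eq ?_,
    (abs_le_of_abs_sub_mul_le hc₂ hb (hdist 2) (hshort 2 (by decide))).trans_eq ?_⟩ <;> norm_num

/-- The integers of absolute value at most `y`; empty for `y < 0`. -/
noncomputable def intBall (y : ℝ) : Finset ℤ := Finset.Icc (-⌊y⌋) ⌊y⌋

theorem mem_intBall {n : ℤ} {y : ℝ} : n ∈ intBall y ↔ |(n : ℝ)| ≤ y := by
  rw [intBall, Finset.mem_Icc, ← abs_le, Int.le_floor, Int.cast_abs]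

theorem card_intBall_mul_le {D y : ℝ} (hD : 0 ≤ D) (hy : 1 ≤ y) :
    ((intBall (D * y)).card : ℝ) ≤ (2 * D + 1) * y := by
  have hfloor : 0 ≤ ⌊D * y⌋ := Int.floor_nonneg.2 (by positivity)
  have hcard : ((intBall (D * y)).card : ℤ) = 2 * ⌊D * y⌋ + 1 := by
    rw [intBall, Int.card_Icc, Int.toNat_of_nonneg (by lia)]
    ring
  have hcast : ((intBall (D * y)).card : ℝ) = 2 * (⌊D * y⌋ : ℝ) + 1 := by exact_mod_cast hcard
  linarith [Int.floor_le (D * y)]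

/-- The indices `(j, k, m)` at scale `j` with `|k₁|, |k₂| ≤ 2 · 2^{j(α-1)/2}`,
`|m₁| ≤ D₁ 2^{jα/2}` and `|m₂|, |m₃| ≤ D₂ 2^{j/2}`. -/
noncomputable def indexBox (α D₁ D₂ : ℝ) (j : ℕ) : Finset (ℕ × (ℤ × ℤ) × (Fin 3 → ℤ)) :=
  {j} ×ˢ (intBall (2 * (2 : ℝ) ^ (j * (α - 1) / 2)) ×ˢ intBall (2 * (2 : ℝ) ^ (j * (α - 1) / 2))) ×ˢ
    Fintype.piFinset ![intBall (D₁ * (2 : ℝ) ^ (j * α / 2)), intBall (D₂ * (2 : ℝ) ^ ((j : ℝ) / 2)),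
      intBall (D₂ * (2 : ℝ) ^ ((j : ℝ) / 2))]

theorem card_indexBox_le {D₁ D₂ : ℝ} (hα : 1 ≤ α) (hD₁ : 0 ≤ D₁) (hD₂ : 0 ≤ D₂) (j : ℕ) :
    ((indexBox α D₁ D₂ j).card : ℝ) ≤
      25 * (2 * D₁ + 1) * (2 * D₂ + 1) ^ 2 * ((2 : ℝ) ^ (3 * α / 2)) ^ j := by
  have hs := card_intBall_mul_le zero_le_two (one_le_two_rpow_mul_sub_one_div_two hα j)
  have ha := card_intBall_mul_le hD₁
    (Real.one_le_rpow one_le_two (by positivity : 0 ≤ j * α / 2))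
  have hb := card_intBall_mul_le hD₂
    (Real.one_le_rpow one_le_two (by positivity : 0 ≤ (j : ℝ) / 2))
  have hscale : ((2 : ℝ) ^ (j * (α - 1) / 2)) ^ 2 * ((2 : ℝ) ^ (j * α / 2) *
      ((2 : ℝ) ^ ((j : ℝ) / 2)) ^ 2) = ((2 : ℝ) ^ (3 * α / 2)) ^ j := by
    simp only [← Real.rpow_mul_natCast two_pos.le, ← Real.rpow_add two_pos]
    ring_nf
  simp only [indexBox, Finset.card_product, Finset.card_singleton, Fintype.card_piFinset,
    Fin.prod_univ_three, Matrix.cons_val, Nat.cast_mul, one_mul]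
  calc _ ≤ (2 * 2 + 1) * (2 : ℝ) ^ (j * (α - 1) / 2) * ((2 * 2 + 1) * (2 : ℝ) ^ (j * (α - 1) / 2)) *
        ((2 * D₁ + 1) * (2 : ℝ) ^ (j * α / 2) * ((2 * D₂ + 1) * (2 : ℝ) ^ ((j : ℝ) / 2)) *
          ((2 * D₂ + 1) * (2 : ℝ) ^ ((j : ℝ) / 2))) := by gcongr
    _ = 25 * (2 * D₁ + 1) * (2 * D₂ + 1) ^ 2 * ((2 : ℝ) ^ (3 * α / 2)) ^ j := by
        rw [← hscale]
        ring

theorem exists_finset_shearletCoeff_ne_zero_subset (hα : 1 ≤ α) (hc₁ : 0 < c.1) (hc₂ : 0 < c.2)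
    (hg : CompactlySupported g) (hψ : CompactlySupported ψ) :
    ∃ E > 0, ∀ j : ℕ, ∃ F : Finset (ShearletIndex α),
      (F.card : ℝ) ≤ E * ((2 : ℝ) ^ (3 * α / 2)) ^ j ∧
        {l | l.1.1 = j ∧ shearletCoeff α c ψ g l ≠ 0} ⊆ F := by
  obtain ⟨R, hR, hgR, hψR⟩ := ((Filter.eventually_ge_atTop 0).and
    (hg.eventually_supportedIn_closedBall.and hψ.eventually_supportedIn_closedBall)).exists
  let D₁ := 6 * R / c.1
  let D₂ := 2 * R / c.2
  refine ⟨25 * (2 * D₁ + 1) * (2 * D₂ + 1) ^ 2, by positivity, fun j => ?_⟩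
  have hinj : Function.Injective (Subtype.val : ShearletIndex α → _) := Subtype.val_injective
  let F := (indexBox α D₁ D₂ j).preimage Subtype.val hinj.injOn
  have hcard : F.card ≤ (indexBox α D₁ D₂ j).card :=
    Finset.card_le_card_of_injOn _ (fun l hl => Finset.mem_preimage.1 hl) hinj.injOn
  refine ⟨F, (Nat.cast_le.2 hcard).trans
    (card_indexBox_le hα (by positivity) (by positivity) j), ?_⟩
  rintro l ⟨rfl, hl⟩
  have hs := one_le_two_rpow_mul_sub_one_div_two hα l.1.1
  obtain ⟨hm₀, hm₁, hm₂⟩ :=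
    abs_latticeIndex_le_of_integral_shearlet_ne_zero hα hc₁ hc₂ hgR hψR l.2.1 l.2.2 hl
  refine Finset.mem_coe.2 (Finset.mem_preimage.2 ?_)
  simp only [indexBox, Finset.mem_product, Finset.mem_singleton, Fintype.mem_piFinset,
    Fin.forall_fin_succ, mem_intBall, true_and]
  refine ⟨⟨abs_le_two_mul_of_abs_le_ceil hs l.2.1, abs_le_two_mul_of_abs_le_ceil hs l.2.2⟩, ?_⟩
  simpa [mem_intBall] using And.intro hm₀ (And.intro hm₁ hm₂)

end Support

section NTerm

variable {ι κ : Type*}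

theorem volume_setOf_pos_and_ofReal_lt (x : ℝ≥0∞) :
    volume {t : ℝ | 0 < t ∧ ENNReal.ofReal t < x} = x := by
  cases x with
  | top => simp [Set.Ioi_def, Real.volume_Ioi]
  | coe r =>
    have hset : {t : ℝ | 0 < t ∧ ENNReal.ofReal t < r} = Set.Ioo 0 (r : ℝ) := by
      ext t
      exact and_congr_right fun ht => ENNReal.ofReal_lt_coe_iff ht.le
    rw [hset, Real.volume_Ioo, sub_zero, ENNReal.ofReal_coe_nnreal]

theorem tsum_eq_lintegral_encard [Countable κ] (f : κ → ℝ≥0∞) :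
    ∑' i, f i = ∫⁻ t in Set.Ioi (0 : ℝ), {i | ENNReal.ofReal t < f i}.encard := by
  have hmeas : ∀ i, MeasurableSet {t : ℝ | ENNReal.ofReal t < f i} := fun i =>
    measurableSet_lt ENNReal.measurable_ofReal measurable_const
  have hterm : ∀ i, f i = ∫⁻ t in Set.Ioi (0 : ℝ),
      {t : ℝ | ENNReal.ofReal t < f i}.indicator 1 t := fun i => by
    rw [lintegral_indicator_one (hmeas i), Measure.restrict_apply (hmeas i), Set.inter_comm]
    exact (volume_setOf_pos_and_ofReal_lt (f i)).symm
  calc ∑' i, f i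
      = ∑' i, ∫⁻ t in Set.Ioi (0 : ℝ), {t : ℝ | ENNReal.ofReal t < f i}.indicator 1 t :=
        tsum_congr hterm
    _ = ∫⁻ t in Set.Ioi (0 : ℝ), ∑' i, {t : ℝ | ENNReal.ofReal t < f i}.indicator 1 t :=
        (lintegral_tsum fun i => (measurable_one.indicator (hmeas i)).aemeasurable).symm
    _ = _ := by
        refine lintegral_congr fun t => ?_
        rw [← ENNReal.tsum_set_one, tsum_subtype _ fun _ => (1 : ℝ≥0∞)]
        rfl

theorem tsum_le_tsum_of_encard_lt_le [Countable ι] [Countable κ] {f : ι → ℝ≥0∞} {g : κ → ℝ≥0∞}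
    (h : ∀ t, {i | t < f i}.encard ≤ {i | t < g i}.encard) : ∑' i, f i ≤ ∑' i, g i := by
  rw [tsum_eq_lintegral_encard, tsum_eq_lintegral_encard]
  exact lintegral_mono fun t => ENat.toENNReal_mono (h _)

theorem le_encard_of_lt_sortedAbs {a : ι → ℂ} {n : ℕ} {t : ℝ≥0∞} (ht : t < sortedAbs a n) :
    (n : ℕ∞) ≤ {i | t < ‖a i‖ₑ}.encard :=
  not_lt.1 fun hlt => (sInf_le (a := t) hlt).not_gt ht

theorem encard_lt_sortedAbs_le (a : ι → ℂ) (F : Finset ι) {N : ℕ} (hF : F.card ≤ N)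
    (t : ℝ≥0∞) :
    {n : Set.Ioi N | t < sortedAbs a n}.encard ≤ {i : {i // i ∉ F} | t < ‖a i‖ₑ}.encard := by
  obtain hfin | hinf := {i : {i // i ∉ F} | t < ‖a i‖ₑ}.finite_or_infinite
  swap
  · rw [hinf.encard_eq]
    exact le_top
  obtain ⟨e, he⟩ := hfin.exists_encard_eq_coe
  have hcover : {i | t < ‖a i‖ₑ} ⊆ F ∪ Subtype.val '' {i : {i // i ∉ F} | t < ‖a i‖ₑ} :=
    fun i hi => (em (i ∈ F)).imp id fun hiF => ⟨⟨i, hiF⟩, hi, rfl⟩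
  have hle : ∀ n, t < sortedAbs a n → n ≤ N + e := fun n hn => by
    have hcard := (le_encard_of_lt_sortedAbs hn).trans
      ((Set.encard_le_encard hcover).trans (Set.encard_union_le _ _))
    rw [Subtype.val_injective.encard_image, he, Set.encard_coe_eq_coe_finsetCard] at hcard
    have : n ≤ F.card + e := by exact_mod_cast hcard
    lia
  have hsub : Subtype.val '' {n : Set.Ioi N | t < sortedAbs a n} ⊆
      (Finset.Ioc N (N + e) : Set ℕ) := by
    rintro _ ⟨n, hn, rfl⟩
    exact Finset.mem_coe.2 (Finset.mem_Ioc.2 ⟨n.2, hle n hn⟩)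
  calc _ = (Subtype.val '' {n : Set.Ioi N | t < sortedAbs a n}).encard :=
        (Subtype.val_injective.encard_image _).symm
    _ ≤ (Finset.Ioc N (N + e) : Set ℕ).encard := Set.encard_le_encard hsub
    _ = _ := by rw [Set.encard_coe_eq_coe_finsetCard, Nat.card_Ioc, Nat.add_sub_cancel_left, he]

theorem tsum_sortedAbs_pow_le [Countable ι] {p N : ℕ} (hp : p ≠ 0) (a : ι → ℂ) (F : Finset ι)
    (hF : F.card ≤ N) :
    ∑' n : Set.Ioi N, sortedAbs a n ^ p ≤ ∑' i : {i // i ∉ F}, ‖a i‖ₑ ^ p := by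
  refine tsum_le_tsum_of_encard_lt_le fun t => ?_
  obtain ⟨s, rfl⟩ : ∃ s : ℝ≥0∞, s ^ p = t :=
    ⟨t ^ (p : ℝ)⁻¹, by
      rw [← ENNReal.rpow_mul_natCast, inv_mul_cancel₀ (Nat.cast_ne_zero.2 hp), ENNReal.rpow_one]⟩
  simpa only [ENNReal.pow_lt_pow_left_iff hp] using encard_lt_sortedAbs_le a F hF s

theorem exists_finset_card_le_of_geometric {s : ℕ → Set ι} {E P : ℝ} (hP : 1 < P)
    (hs : ∀ j, ∃ F : Finset ι, F.card ≤ E * P ^ j ∧ s j ⊆ F) (J : ℕ) :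
    ∃ F : Finset ι, F.card ≤ E / (P - 1) * (P ^ J - 1) ∧ ∀ j < J, s j ⊆ F := by
  classical
  choose F hcard hsub using hs
  refine ⟨(Finset.range J).biUnion F, ?_, fun j hj i hi =>
    Finset.mem_coe.2 (Finset.mem_biUnion.2 ⟨j, Finset.mem_range.2 hj, hsub j hi⟩)⟩
  calc (((Finset.range J).biUnion F).card : ℝ)
      ≤ ∑ j ∈ Finset.range J, ((F j).card : ℝ) := by exact_mod_cast Finset.card_biUnion_le
    _ ≤ ∑ j ∈ Finset.range J, E * P ^ j := Finset.sum_le_sum fun j _ => hcard j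
    _ = E / (P - 1) * (P ^ J - 1) := by
        rw [← Finset.mul_sum, geom_sum_eq hP.ne']
        ring

theorem exists_mul_pow_sub_one_le {E P x : ℝ} (hE : 0 < E) (hP : 1 < P) (hx : 0 ≤ x) :
    ∃ J : ℕ, E * (P ^ J - 1) ≤ x ∧ x ≤ E * P * P ^ J := by
  obtain ⟨J, hle, hlt⟩ := exists_nat_pow_near (le_add_of_nonneg_left (div_nonneg hx hE.le)) hP
  refine ⟨J, ?_, ?_⟩
  · rwa [mul_comm, ← le_div_iff₀ hE, sub_le_iff_le_add]
  · rw [mul_assoc, ← pow_succ', mul_comm, ← div_le_iff₀ hE]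
    linarith

theorem inv_rpow_pow_le_mul_rpow_neg {E P x θ : ℝ} {J : ℕ} (hE : 0 < E) (hP : 0 < P) (hx : 0 < x)
    (hθ : 0 ≤ θ) (h : x ≤ E * P ^ J) : ((P ^ θ) ^ J)⁻¹ ≤ E ^ θ * x ^ (-θ) := by
  rw [Real.rpow_neg hx.le, ← div_eq_mul_inv, inv_eq_one_div,
    div_le_div_iff₀ (by positivity) (by positivity), one_mul, Real.rpow_pow_comm hP.le,
    ← Real.mul_rpow hE.le (by positivity)]
  exact Real.rpow_le_rpow hx.le h hθ

theorem exists_tsum_sortedAbs_pow_le [Countable ι] {a : ι → ℂ} {scale : ι → ℕ} {p : ℕ}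
    {E P θ : ℝ} (hp : p ≠ 0) (hE : 0 < E) (hP : 1 < P) (hθ : 0 ≤ θ)
    (hcount : ∀ j, ∃ F : Finset ι, F.card ≤ E * P ^ j ∧ {i | scale i = j ∧ a i ≠ 0} ⊆ F)
    (henergy : ∑' i, ENNReal.ofReal ((P ^ θ) ^ scale i) * ‖a i‖ₑ ^ p ≠ ∞) :
    ∃ C : ℝ, ∀ N : ℕ, 1 ≤ N →
      ∑' n : Set.Ioi N, sortedAbs a n ^ p ≤ ENNReal.ofReal (C * (N : ℝ) ^ (-θ)) := by
  have hP₀ : 0 < P := one_pos.trans hP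
  have hPθ : 1 ≤ P ^ θ := Real.one_le_rpow hP.le hθ
  have hE' : 0 < E / (P - 1) := div_pos hE (sub_pos.2 hP)
  have hE'P : 0 < E / (P - 1) * P := mul_pos hE' hP₀
  set S := ∑' i, ENNReal.ofReal ((P ^ θ) ^ scale i) * ‖a i‖ₑ ^ p
  refine ⟨(E / (P - 1) * P) ^ θ * S.toReal, fun N hN => ?_⟩
  obtain ⟨J, hJN, hNJ⟩ := exists_mul_pow_sub_one_le hE' hP N.cast_nonneg
  obtain ⟨F, hFcard, hF⟩ := exists_finset_card_le_of_geometric hP hcount J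
  have hterm : ∀ i ∉ F, ‖a i‖ₑ ^ p ≤
      ENNReal.ofReal ((P ^ θ) ^ J)⁻¹ * (ENNReal.ofReal ((P ^ θ) ^ scale i) * ‖a i‖ₑ ^ p) := by
    intro i hi
    obtain ha | ha := eq_or_ne (a i) 0
    · simp [ha, hp]
    have hJi : J ≤ scale i := not_lt.1 fun hlt => hi (hF _ hlt ⟨rfl, ha⟩)
    rw [← mul_assoc, ← ENNReal.ofReal_mul (by positivity)]
    refine le_mul_of_one_le_left zero_le (ENNReal.one_le_ofReal.2 ?_)
    rw [← div_eq_inv_mul, one_le_div (by positivity)]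
    exact pow_le_pow_right₀ hPθ hJi
  calc ∑' n : Set.Ioi N, sortedAbs a n ^ p
      ≤ ∑' i : {i // i ∉ F}, ‖a i‖ₑ ^ p :=
        tsum_sortedAbs_pow_le hp a F (Nat.cast_le.1 (hFcard.trans hJN))
    _ ≤ ∑' i : {i // i ∉ F}, ENNReal.ofReal ((P ^ θ) ^ J)⁻¹ *
          (ENNReal.ofReal ((P ^ θ) ^ scale i) * ‖a i‖ₑ ^ p) :=
        ENNReal.tsum_le_tsum fun i => hterm i i.2
    _ ≤ ENNReal.ofReal ((P ^ θ) ^ J)⁻¹ * S := by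
        rw [ENNReal.tsum_mul_left]
        gcongr
        exact ENNReal.tsum_comp_le_tsum_of_injective Subtype.val_injective _
    _ = ENNReal.ofReal (((P ^ θ) ^ J)⁻¹ * S.toReal) := by
        rw [ENNReal.ofReal_mul (by positivity), ENNReal.ofReal_toReal henergy]
    _ ≤ _ := by
        refine ENNReal.ofReal_le_ofReal ?_
        rw [mul_right_comm]
        gcongr
        exact inv_rpow_pow_le_mul_rpow_neg hE'P hP₀ (Nat.cast_pos.2 hN) hθ hNJ

end NTerm

theorem isCompact_unitCube : IsCompact unitCube := by
  have hcube : unitCube = EuclideanSpace.equiv (Fin 3) ℝ ⁻¹' Set.univ.pi fun _ => Set.Icc 0 1 := by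
    ext x
    rw [Set.mem_preimage, Set.mem_univ_pi]
    rfl
  rw [hcube]
  exact (EuclideanSpace.equiv (Fin 3) ℝ).toHomeomorph.isCompact_preimage.2
    (isCompact_univ_pi fun _ => isCompact_Icc)

theorem mainTheorem11_general (α β δ γ : ℝ) (c : ℝ × ℝ) (ψ g : L2R3)
    (hα : 1 ≤ α) (hc1 : 0 < c.1) (hc2 : 0 < c.2) (hβ : 0 ≤ β)
    (hg : InSobolev β g) (hgsupp : CompactlySupported g)
    (hψsupp : CompactlySupported ψ) (hψ : IsFeasible δ γ ψ)
    (hδ : 2 + β < δ) (hγ : 1 < γ) :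
    ∃ C : ℝ, ∀ N : ℕ, 1 ≤ N →
      ∑' n : Set.Ioi N, sortedAbs (shearletCoeff α c ψ g) n ^ 2 ≤
        ENNReal.ofReal (C * (N : ℝ) ^ (-(2 * β / 3))) := by
  have : Countable (ShearletIndex α) := Subtype.countable
  have hP : 1 < (2 : ℝ) ^ (3 * α / 2) := Real.one_lt_rpow one_lt_two (by linarith)
  have hweight : ∀ j : ℕ,
      (((2 : ℝ) ^ (3 * α / 2)) ^ (2 * β / 3)) ^ j = (2 : ℝ) ^ (j * α * β) := fun j => by
    rw [← Real.rpow_mul two_pos.le, ← Real.rpow_mul_natCast two_pos.le]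
    ring_nf
  obtain ⟨E, hE, hcount⟩ :=
    exists_finset_shearletCoeff_ne_zero_subset hα hc1 hc2 hgsupp hψsupp
  have henergy := tsum_weighted_shearletCoeff_sq_ne_top (α := α) (by linarith) hc1 hc2 hβ hg
    hψsupp.integrable hψ hδ hγ
  refine exists_tsum_sortedAbs_pow_le two_ne_zero hE hP (by positivity) hcount ?_
  simpa only [hweight] using henergy

theorem mainTheorem11 (α β δ γ : ℝ) (c : ℝ × ℝ) (ψ g : L2R3)
    (hα : 1 < α) (hα2 : α ≤ 2) (hc1 : 0 < c.1) (hc2 : 0 < c.2) (hβ : 0 ≤ β)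
    (hg : InSobolev β g) (hgsupp : SupportedIn g unitCube)
    (hψsupp : CompactlySupported ψ) (hψ : IsFeasible δ γ ψ)
    (hδ : 2 * γ + β < δ) (hγ : 3 < γ) :
    ∃ C : ℝ, ∀ N : ℕ, 1 ≤ N →
      ∑' n : Set.Ioi N, sortedAbs (shearletCoeff α c ψ g) n ^ 2 ≤
        ENNReal.ofReal (C * (N : ℝ) ^ (-(2 * β / 3))) :=
  mainTheorem11_general α β δ γ c ψ g hα.le hc1 hc2 hβ hg ⟨unitCube, isCompact_unitCube, hgsupp⟩
    hψsupp hψ (by linarith) (by linarith)
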